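/- Let $L$ be a countable relational first-order signature and let $X$ be a countable $L$-structure with the following properties. * $X$ is $\omega$-categorical: up to isomorphism, $X$ is the only countable model of its first-order theory. * $X$ is homogeneous: every isomorphism between finite substructures of $X$ extends to an automorphism of $X$. * $X$ has no algebraicity: for every finite substructure $A\subseteq X$, the set of all $b\in X$ whose orbit under the pointwise stabilizer of $A$ in $\mathrm{Aut}(X)$ is finite is equal to $A$. * $X$ admits weak elimination of imaginaries: whenever $S\subseteq X^m$ is first-order definable without parameters and $\alpha\subseteq S$ is an equivalence class of an equivalence relation on $S$ that is first-order definable without parameters, there are $n\ge 0$ and a first-order formula $\varphi(\bar x,\bar y)$ such that the set $\{\bar c\in X^n : \alpha=\{\bar x\in X^m : \varphi(\bar x,\bar c)\}\}$ is finite and non-empty. Then $\mathrm{Aut}(X)$, with the topology of pointwise convergence ($X$ being discrete), has Kazhdan's property (T), with a compact Kazhdan set: there exist a compact set $Q\subseteq \mathrm{Aut}(X)$ and $\varepsilon>0$ such that every strongly continuous unitary representation $\pi$ of $\mathrm{Aut}(X)$ on a complex Hilbert space for which there is a non-zero vector $\xi$ with $\|\pi(g)\xi-\xi\|\le\varepsilon\|\xi\|$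 for all $g\in Q$ has a non-zero vector fixed by all of $\mathrm{Aut}(X)$. -/

import Mathlib

universe u v w z

namespace OligoT

open FirstOrder FirstOrder.Language Cardinal

/-! ### Kazhdan's property (T) for topological groups -/

/-- A (strongly continuous) unitary representation of a topological group `G` on the complex
Hilbert space `H`. -/
structure UnitaryRep (G : Type u) [Group G] [TopologicalSpace G]
    (H : Type z) [NormedAddCommGroup H] [InnerProductSpace ℂ H] where
  toHom : G →* (H ≃ₗᵢ[ℂ] H)
  strongly_continuous : ∀ ξ : H, Continuous fun g : G => toHom g ξ

namespace UnitaryRep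

variable {G : Type u} [Group G] [TopologicalSpace G]
  {H : Type z} [NormedAddCommGroup H] [InnerProductSpace ℂ H]

/-- The non-zero vector `ξ` is `(Q, ε)`-invariant for `π`. -/
def IsAlmostInvariant (π : UnitaryRep G H) (Q : Set G) (ε : ℝ) (ξ : H) : Prop :=
  ξ ≠ 0 ∧ ∀ g ∈ Q, ‖π.toHom g ξ - ξ‖ ≤ ε * ‖ξ‖

/-- The non-zero vector `ξ` is fixed by the whole group. -/
def IsInvariant (π : UnitaryRep G H) (ξ : H) : Prop :=
  ξ ≠ 0 ∧ ∀ g : G, π.toHom g ξ = ξ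

end UnitaryRep

/-- `(Q, ε)` is a Kazhdan pair for `G`: every unitary representation of `G` on a complex Hilbert
space (in the universe `z`) that has a `(Q, ε)`-invariant vector has a non-zero invariant vector. -/
def IsKazhdanPair (G : Type u) [Group G] [TopologicalSpace G] (Q : Set G) (ε : ℝ) : Prop :=
  ∀ (H : Type z) [NormedAddCommGroup H] [InnerProductSpace ℂ H] [CompleteSpace H]
    (π : UnitaryRep G H),
    (∃ ξ : H, π.IsAlmostInvariant Q ε ξ) → ∃ η : H, π.IsInvariant η

/-- Kazhdan's property (T), with a compact Kazhdan set. -/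
def HasPropertyT (G : Type u) [Group G] [TopologicalSpace G] [IsTopologicalGroup G] : Prop :=
  ∃ Q : Set G, IsCompact Q ∧ ∃ ε : ℝ, 0 < ε ∧ IsKazhdanPair.{u, z} G Q ε

/-! ### The automorphism group of a first-order structure, as a topological group -/

section Aut

variable (L : FirstOrder.Language.{u, v}) (X : Type w) [L.Structure X]

/-- The automorphism group of the structure `X`; the product is composition. -/
abbrev Aut : Type w := X ≃[L] X

instance Aut.instGroup : Group (Aut L X) where
  mul g h := g.comp h
  one := FirstOrder.Language.Equiv.refl L X
  inv g := g.symm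
  mul_assoc _ _ _ := rfl
  one_mul _ := rfl
  mul_one _ := rfl
  inv_mul_cancel g := FirstOrder.Language.Equiv.symm_comp_self g

instance Aut.instMulAction : MulAction (Aut L X) X where
  smul g x := g x
  one_smul _ := rfl
  mul_smul _ _ _ := rfl

/-- The topology of pointwise convergence, where `X` is discrete. -/
instance Aut.instTopologicalSpace : TopologicalSpace (Aut L X) :=
  TopologicalSpace.induced (fun (g : Aut L X) (x : X) => g x)
    (@Pi.topologicalSpace X (fun _ => X) (fun _ => ⊥))

variable {L X}

theorem Aut.continuous_iff {Y : Type*} [TopologicalSpace Y] {f : Y → Aut L X} :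
    Continuous f ↔ ∀ x y : X, IsOpen {t : Y | f t x = y} := by
  let _ : TopologicalSpace X := ⊥
  have _ : DiscreteTopology X := ⟨rfl⟩
  rw [continuous_induced_rng, continuous_pi_iff]
  refine forall_congr' fun x => ?_
  rw [continuous_discrete_rng]
  rfl

theorem Aut.isOpen_setOf_apply_eq (x y : X) : IsOpen {g : Aut L X | g x = y} :=
  Aut.continuous_iff.1 continuous_id x y

instance Aut.instIsTopologicalGroup : IsTopologicalGroup (Aut L X) where
  continuous_mul := by
    refine Aut.continuous_iff.2 fun x y => ?_
    have h : {t : Aut L X × Aut L X | (t.1 * t.2) x = y} =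
        ⋃ z : X, {g : Aut L X | g z = y} ×ˢ {g : Aut L X | g x = z} := by
      ext ⟨a, b⟩
      simp only [Set.mem_ofPred_eq, Set.mem_iUnion, Set.mem_prod]
      exact ⟨fun h => ⟨b x, h, rfl⟩, fun ⟨z, h1, h2⟩ => by subst h2; exact h1⟩
    rw [h]
    exact isOpen_iUnion fun z =>
      (Aut.isOpen_setOf_apply_eq z y).prod (Aut.isOpen_setOf_apply_eq x z)
  continuous_inv := by
    refine Aut.continuous_iff.2 fun x y => ?_
    have h : {g : Aut L X | g⁻¹ x = y} = {g : Aut L X | g y = x} := by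
      ext g
      exact ⟨fun h => by
          have h' : g.symm x = y := h
          simp [← h'],
        fun h => by
          have h' : g y = x := h
          change g.symm x = y
          simp [← h']⟩
    rw [h]
    exact Aut.isOpen_setOf_apply_eq y x

end Aut

/-! ### Model-theoretic hypotheses -/

section Model

variable (L : FirstOrder.Language.{u, v}) (X : Type w) [L.Structure X]

/-- `X` is `ω`-categorical: it is countable and, up to isomorphism, the only countable model of its
complete theory (if `X` is finite then all models of the theory are isomorphic anyway). -/
structure IsOmegaCategorical : Prop where
  countable : Countable X
  categorical : (ℵ₀ : Cardinal.{w}).Categorical (L.completeTheory X)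

/-- The algebraic closure of `A`: the points with a finite orbit under the pointwise stabilizer
of `A` in the automorphism group. -/
def algClosure (A : Set X) : Set X :=
  {b | (MulAction.orbit (fixingSubgroup (Aut L X) A) b).Finite}

/-- `X` has no algebraicity: every finite substructure is its own algebraic closure. -/
def NoAlgebraicity : Prop :=
  ∀ A : L.Substructure X, (A : Set X).Finite → algClosure L X (A : Set X) = A

variable {X}

/-- `α ⊆ Xᵐ` is an imaginary element: an equivalence class of an equivalence relation `θ`, definable
without parameters, on a subset `S` of `Xᵐ`, definable without parameters. -/
def IsImaginary {m : ℕ} (α : Set (Fin m → X)) : Prop :=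
  ∃ (S : Set (Fin m → X)) (θ : Setoid S),
    (∅ : Set X).Definable L S ∧
    (∅ : Set X).Definable L
      {v : Fin m ⊕ Fin m → X | ∃ (h₁ : v ∘ Sum.inl ∈ S) (h₂ : v ∘ Sum.inr ∈ S),
        θ ⟨v ∘ Sum.inl, h₁⟩ ⟨v ∘ Sum.inr, h₂⟩} ∧
    ∃ a : S, α = {x | ∃ h : x ∈ S, θ ⟨x, h⟩ a}

/-- The set of tuples `c` of parameters for which `φ(·, c)` defines `α`. -/
def codes {m n : ℕ} (φ : L.Formula (Fin m ⊕ Fin n)) (α : Set (Fin m → X)) : Set (Fin n → X) :=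
  {c | α = {x | φ.Realize (Sum.elim x c)}}

variable (X)

/-- Weak elimination of imaginaries: every imaginary `α` is defined by a formula `φ(x, c)` for
finitely many, and at least one, tuples of parameters `c`. -/
def WeakElimImaginaries : Prop :=
  ∀ (m : ℕ) (α : Set (Fin m → X)), IsImaginary L α →
    ∃ (n : ℕ) (φ : L.Formula (Fin m ⊕ Fin n)), (codes L φ α).Finite ∧ (codes L φ α).Nonempty

end Model

end OligoT

/-! Suppose `X` is infinite and put G = Aut(X), writing G_A for the pointwise stabilizer of a finite
A ⊆ X. Compactness and categoricity give the Ryll-Nardzewski theorem: orbits on tuples are definable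
and finite in number for each length (`definable_orbit`, `finite_orbits`). Weak elimination of
imaginaries attaches to each subgroup V containing some G_A a finite V-invariant set C with G_C ≤ V
(`exists_finset_of_fixing_le`), and absence of algebraicity puts C inside every finite D with G_D ≤
V. The consequences for stabilizers are collected in `StabilizerCalculus`, and the representation
theory uses nothing else about `X`.

Let P_A be the projection to the G_A-fixed vectors. The crux is P_B P_A = P_{A∩B}
(`proj_of_mem_fixed`). It rests on two facts: P_A ξ is a weak limit of points of the G_A-orbit of ξ,
not just of convex combinations of them, and the coefficients ⟨gξ, ξ⟩ of a G_A-fixed vector take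
finitely many values. Hence the norms of the iterates of P_A P_B P_A on such a vector stabilize.
Commutation splits the Hilbert space orthogonally into pieces `pure F`, indexed by the finite F ⊆ X
and permuted by G. A vector ξ thus becomes a measure of total mass ‖ξ‖² on finite sets, and the
empty set carries no mass if there are no invariant vectors.

It remains to find two automorphisms for which no such measure is almost invariant. A generic
construction gives g_true, g_false and a four-colouring of `X` such that g_i sends every point not
coloured (i, false) to one coloured (i, true) (`exists_pingPong`). Weighting each F by its
proportions of colours transfers the paradox from points to nonempty finite sets, so {g_true,
g_false} is a Kazhdan set. -/

namespace OligoT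

open FirstOrder FirstOrder.Language Cardinal

/-! ### Types, homogeneity and compactness. -/

section ModelTheory

variable {L : FirstOrder.Language.{u, v}} {X : Type w} [L.Structure X]

/-- Sets definable without parameters are invariant under automorphisms. -/
theorem smul_mem_iff_of_definable {α : Type*} {S : Set (α → X)} (hS : (∅ : Set X).Definable L S)
    (g : Aut L X) (a : α → X) : g • a ∈ S ↔ a ∈ S := by
  obtain ⟨φ, rfl⟩ := Set.empty_definable_iff.1 hS
  exact StrongHomClass.realize_formula g φ

theorem orbit_subset_of_definable {α : Type*} {S : Set (α → X)}
    (hS : (∅ : Set X).Definable L S) {a : α → X} (ha : a ∈ S) :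
    MulAction.orbit (Aut L X) a ⊆ S := by
  rintro _ ⟨g, rfl⟩
  exact (smul_mem_iff_of_definable hS g a).2 ha

theorem definable_setOf_relMap {α : Type*} {k : ℕ} (R : L.Relations k) (f : Fin k → α) :
    (∅ : Set X).Definable L {v : α → X | Structure.RelMap R (v ∘ f)} := by
  refine Set.empty_definable_iff.2 ⟨R.formula fun j => Term.var (f j), ?_⟩
  ext v
  simp [Formula.realize_rel, Function.comp_def]

theorem definable_setOf_eq {α : Type*} (i j : α) :
    (∅ : Set X).Definable L {v : α → X | v i = v j} := by
  refine Set.empty_definable_iff.2 ⟨(Term.var i).equal (Term.var j), ?_⟩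
  ext v
  simp

/-- In an ultrahomogeneous relational structure, tuples with the same type are conjugate. -/
theorem exists_smul_eq_of_definable [L.IsRelational] (hhom : L.IsUltrahomogeneous X) {n : ℕ}
    {a b : Fin n → X}
    (h : ∀ S : Set (Fin n → X), (∅ : Set X).Definable L S → (a ∈ S ↔ b ∈ S)) :
    ∃ g : Aut L X, g • a = b := by
  let A : L.Substructure X := Substructure.closure L (Set.range a)
  have hA : (A : Set X) = Set.range a := Substructure.closure_eq_of_isRelational L _
  have hidx : ∀ s : A, ∃ i, a i = s := fun s => by
    have : (s : X) ∈ (A : Set X) := s.2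
    rwa [hA] at this
  choose idx hidx using hidx
  have heq : ∀ i j, a i = a j ↔ b i = b j := fun i j => h _ (definable_setOf_eq i j)
  let f : A ↪[L] X :=
    { toFun := fun s => b (idx s)
      inj' := fun s t hst => by
        have := (heq (idx s) (idx t)).2 hst
        rw [hidx, hidx] at this
        exact Subtype.ext this
      map_fun' := fun {k} F => isEmptyElim F
      map_rel' := fun {k} R x => by
        have h1 := h _ (definable_setOf_relMap R fun j => idx (x j))
        have h2 : a ∘ (fun j => idx (x j)) = fun j => (x j : X) := funext fun j => hidx (x j)
        simp only [Set.mem_ofPred_eq, h2] at h1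
        exact h1.symm }
  obtain ⟨g, hg⟩ := hhom A (Substructure.fg_closure (Set.finite_range a)) f
  refine ⟨g, funext fun i => ?_⟩
  have hi : a i ∈ A := Substructure.subset_closure ⟨i, rfl⟩
  have h3 : f ⟨a i, hi⟩ = g (a i) := by rw [hg]; rfl
  have h4 : b (idx ⟨a i, hi⟩) = b i := (heq _ _).1 (hidx ⟨a i, hi⟩)
  exact h3.symm.trans h4

theorem card_le_aleph0 [L.IsRelational] [Countable (Σ n, L.Relations n)] : L.card ≤ ℵ₀ := by
  have : Countable L.Symbols := by unfold Language.Symbols; infer_instance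
  exact Cardinal.mk_le_aleph0_iff.2 this

/-- Compactness inside a countably categorical structure: it realizes every type. -/
theorem nonempty_iInter_of_definable [L.IsRelational] [Countable (Σ n, L.Relations n)] [Infinite X]
    (hcat : IsOmegaCategorical L X) {n : ℕ} {ι : Type*} (D : ι → Set (Fin n → X))
    (hD : ∀ i, (∅ : Set X).Definable L (D i))
    (hfin : ∀ s : Finset ι, (⋂ i ∈ s, D i).Nonempty) : (⋂ i, D i).Nonempty := by
  have := hcat.countable
  choose φ hφ using fun i => Set.empty_definable_iff.1 (hD i)
  -- The `n` new constants name a tuple that should lie in all the sets `D i`.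
  let T : ι → L[[Fin n]].Theory := fun i =>
    (L.lhomWithConstants (Fin n)).onTheory (L.completeTheory X) ∪ {Formula.equivSentence (φ i)}
  rcases isEmpty_or_nonempty ι with hι | ⟨⟨i₀⟩⟩
  · simp
  have hsat : Theory.IsSatisfiable (⋃ i, T i) := by
    rw [Theory.isSatisfiable_iUnion_iff_isSatisfiable_iUnion_finset]
    intro s
    obtain ⟨v, hv⟩ := hfin s
    let _ : (constantsOn (Fin n)).Structure X := constantsOn.structure v
    have hX : X ⊨ (⋃ i ∈ s, T i) := by
      refine Theory.model_iff _ |>.2 fun ψ hψ => ?_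
      simp only [Set.mem_iUnion] at hψ
      obtain ⟨i, hi, hψ | hψ⟩ := hψ
      · have h1 : X ⊨ (L.lhomWithConstants (Fin n)).onTheory (L.completeTheory X) :=
          (LHom.onTheory_model _ _).2 inferInstance
        exact h1.realize_of_mem ψ hψ
      · rw [Set.mem_singleton_iff.1 hψ]
        refine (Formula.realize_equivSentence X (φ i)).2 ?_
        have h2 : v ∈ D i := by
          simp only [Set.mem_iInter] at hv
          exact hv i hi
        rw [hφ] at h2
        exact h2
    exact Theory.Model.isSatisfiable X
  obtain ⟨M⟩ := hsat
  have hsub : ∀ i, T i ⊆ ⋃ i, T i := fun i => Set.subset_iUnion T i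
  have hMX : M ⊨ (L.lhomWithConstants (Fin n)).onTheory (L.completeTheory X) :=
    M.is_model.mono (Set.subset_union_left.trans (hsub i₀))
  have hMinf : Infinite M := by
    let _ : L.Structure M := (L.lhomWithConstants (Fin n)).reduct M
    have : (L.lhomWithConstants (Fin n)).IsExpansionOn M := LHom.isExpansionOn_reduct _ _
    have h1 : M ⊨ L.completeTheory X := (LHom.onTheory_model _ _).1 hMX
    exact ((elementarilyEquivalent_iff.2 fun ψ =>
      (realize_iff_of_model_completeTheory X M ψ).symm).infinite_iff (L := L) (M := X)).1
      inferInstance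
  have hcard : Cardinal.lift.{w} (L[[Fin n]]).card ≤
      Cardinal.lift.{max u v} (ℵ₀ : Cardinal.{w}) := by
    rw [card_withConstants]
    simpa using card_le_aleph0
  -- Löwenheim–Skolem makes the model countable; its `L`-reduct is then isomorphic to `X`, and the
  -- constants are carried to the required tuple.
  obtain ⟨N, hMN, hN⟩ := exists_elementarilyEquivalent_card_eq L[[Fin n]] M (ℵ₀ : Cardinal.{w})
    le_rfl hcard
  have hNT : N ⊨ (⋃ i, T i) := (hMN.theory_model_iff).1 M.is_model
  let _ : L.Structure N := (L.lhomWithConstants (Fin n)).reduct N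
  have : (L.lhomWithConstants (Fin n)).IsExpansionOn N := LHom.isExpansionOn_reduct _ _
  have hNX : N ⊨ L.completeTheory X := (LHom.onTheory_model _ _).1
    (hNT.mono (Set.subset_union_left.trans (hsub i₀)))
  have hNne : Nonempty N := by
    rw [← Cardinal.mk_ne_zero_iff, hN]
    exact Cardinal.aleph0_ne_zero
  obtain ⟨e⟩ := hcat.categorical (Theory.ModelType.of _ N) (Theory.ModelType.of _ X) hN
    (Cardinal.mk_eq_aleph0 X)
  let e' : N ≃[L] X := e
  refine ⟨fun j => e' (L.con j : N), Set.mem_iInter.2 fun i => ?_⟩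
  rw [hφ]
  have h1 : (Formula.equivSentence (φ i)).Realize N :=
    hNT.realize_of_mem _ (hsub i (Or.inr rfl))
  rw [Formula.realize_equivSentence] at h1
  exact (StrongHomClass.realize_formula e' (φ i)).2 h1

end ModelTheory

/-! ### Ryll-Nardzewski: atomicity and oligomorphy. -/

open FirstOrder FirstOrder.Language Cardinal

section Oligomorphic

variable {L : FirstOrder.Language.{u, v}} {X : Type w} [L.Structure X]

/-- Every nonempty definable set contains a definable orbit. -/
theorem exists_definable_orbit [L.IsRelational] [Countable (Σ n, L.Relations n)] [Infinite X]
    (hcat : IsOmegaCategorical L X) (hhom : L.IsUltrahomogeneous X) {n : ℕ}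
    {S : Set (Fin n → X)} (hS : (∅ : Set X).Definable L S) (hne : S.Nonempty) :
    ∃ a ∈ S, (∅ : Set X).Definable L (MulAction.orbit (Aut L X) a) := by
  have := hcat.countable
  by_contra! hcon
  let P := {S' : Set (Fin n → X) // (∅ : Set X).Definable L S' ∧ S'.Nonempty ∧ S' ⊆ S}
  -- If `a` survived in every nonempty definable subset of `S'`, all points of `S'` would have the
  -- type of `a`, and `S'` would be a definable orbit. Removing the countably many tuples one at a
  -- time then contradicts compactness.
  have step : ∀ (p : P) (a : Fin n → X), ∃ q : P, q.1 ⊆ p.1 ∧ a ∉ q.1 := by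
    rintro ⟨S', hd, hne', hsub⟩ a
    by_contra! hall
    have hmem : ∀ E : Set (Fin n → X), (∅ : Set X).Definable L E → (S' ∩ E).Nonempty → a ∈ E :=
      fun E hE hEne => (hall ⟨S' ∩ E, hd.inter hE, hEne, Set.inter_subset_left.trans hsub⟩
        Set.inter_subset_left).2
    have haS : a ∈ S' := hall ⟨S', hd, hne', hsub⟩ subset_rfl
    refine hcon a (hsub haS) ?_
    suffices MulAction.orbit (Aut L X) a = S' by rwa [this]
    refine (orbit_subset_of_definable hd haS).antisymm fun b hb => ?_
    refine exists_smul_eq_of_definable hhom fun E hE =>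
      ⟨fun haE => ?_, fun hbE => hmem E hE ⟨b, hb, hbE⟩⟩
    by_contra hbE
    exact hmem Eᶜ hE.compl ⟨b, hb, hbE⟩ haE
  choose next hnext hnot using step
  obtain ⟨enum, henum⟩ := exists_surjective_nat (Fin n → X)
  let chain : ℕ → P := fun k => Nat.rec ⟨S, hS, hne, subset_rfl⟩ (fun k p => next p (enum k)) k
  have hanti : Antitone fun k => (chain k).1 := antitone_nat_of_succ_le fun k => hnext _ _
  obtain ⟨a, ha⟩ := nonempty_iInter_of_definable hcat (fun k => (chain k).1)
    (fun k => (chain k).2.1) (fun s => by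
      obtain ⟨a, ha⟩ := (chain (s.sup id)).2.2.1
      exact ⟨a, Set.mem_iInter₂.2 fun i hi => hanti (Finset.le_sup (f := id) hi) ha⟩)
  obtain ⟨k, rfl⟩ := henum a
  exact hnot (chain k) (enum k) (Set.mem_iInter.1 ha (k + 1))

variable (L) in
/-- A set of points is atomic if all tuples of its points have definable orbits. -/
def IsAtomicSet (F : Set X) : Prop :=
  ∀ (k : ℕ) (a : Fin k → X), (∀ i, a i ∈ F) →
    (∅ : Set X).Definable L (MulAction.orbit (Aut L X) a)

theorem IsAtomicSet.of_range {n : ℕ} {a : Fin n → X}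
    (ha : (∅ : Set X).Definable L (MulAction.orbit (Aut L X) a)) {F : Set X}
    (hF : F ⊆ Set.range a) : IsAtomicSet L F := by
  intro k b hb
  choose j hj using fun i => hF (hb i)
  convert ha.image_comp j using 1
  have hb' : b = a ∘ j := funext fun i => (hj i).symm
  ext c
  constructor
  · rintro ⟨g, rfl⟩
    exact ⟨g • a, ⟨g, rfl⟩, by rw [hb']; rfl⟩
  · rintro ⟨_, ⟨g, rfl⟩, rfl⟩
    exact ⟨g, by rw [hb']; rfl⟩

/-- A witness for a formula over a finite atomic set can be chosen so that the set stays atomic. -/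
theorem IsAtomicSet.exists_insert [L.IsRelational] [Countable (Σ n, L.Relations n)] [Infinite X]
    (hcat : IsOmegaCategorical L X) (hhom : L.IsUltrahomogeneous X)
    {F : Finset X} (hF : IsAtomicSet L (F : Set X)) {k : ℕ} {S : Set (Fin (k + 1) → X)}
    (hS : (∅ : Set X).Definable L S) {x : Fin k → X} (hx : ∀ i, x i ∈ F)
    (hex : ∃ b, (Fin.snoc x b : Fin (k + 1) → X) ∈ S) :
    ∃ b, (Fin.snoc x b : Fin (k + 1) → X) ∈ S ∧ IsAtomicSet L (insert b (F : Set X)) := by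
  let a : Fin F.card → X := fun i => F.equivFin.symm i
  have ha : ∀ i, a i ∈ F := fun i => (F.equivFin.symm i).2
  have hFa : (F : Set X) ⊆ Set.range a := fun y hy => ⟨F.equivFin ⟨y, hy⟩, by simp [a]⟩
  choose j hj using fun i => hFa (hx i)
  have hxj : x = a ∘ j := funext fun i => (hj i).symm
  let idx : Fin (k + 1) → Fin (F.card + 1) := Fin.snoc (fun i => (j i).castSucc) (Fin.last _)
  -- All conditions on the enumerated set `F` together with the witness. A definable orbit inside
  -- this set is moved back so that its first coordinates are exactly `a`.
  let S' : Set (Fin (F.card + 1) → X) :=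
    {v | v ∘ Fin.castSucc ∈ MulAction.orbit (Aut L X) a} ∩ {v | v ∘ idx ∈ S}
  have hS' : (∅ : Set X).Definable L S' :=
    ((hF _ a ha).preimage_comp Fin.castSucc).inter (hS.preimage_comp idx)
  have hidx : ∀ b, (Fin.snoc a b : Fin (F.card + 1) → X) ∘ idx = Fin.snoc x b := fun b => by
    ext i
    refine Fin.lastCases ?_ (fun i => ?_) i <;> simp [idx, hxj]
  have hcast : ∀ b, (Fin.snoc a b : Fin (F.card + 1) → X) ∘ Fin.castSucc = a := fun b => by
    ext i; simp
  obtain ⟨b, hb⟩ := hex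
  have hmem : (Fin.snoc a b : Fin (F.card + 1) → X) ∈ S' :=
    ⟨by rw [Set.mem_ofPred_eq, hcast]; exact MulAction.mem_orbit_self a,
      by rwa [Set.mem_ofPred_eq, hidx]⟩
  obtain ⟨v, ⟨⟨g, hg⟩, hvS⟩, hv⟩ := exists_definable_orbit hcat hhom hS' ⟨_, hmem⟩
  have hgv : g⁻¹ • v = Fin.snoc a (g⁻¹ • v (Fin.last _)) := by
    ext i
    refine Fin.lastCases ?_ (fun i => ?_) i
    · simp
    · have := congrFun hg i
      simp only [Fin.snoc_castSucc]
      rw [Pi.smul_apply, inv_smul_eq_iff]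
      exact this.symm
  refine ⟨g⁻¹ • v (Fin.last _), ?_, ?_⟩
  · rw [← hidx, ← hgv]
    exact (smul_mem_iff_of_definable hS g⁻¹ (v ∘ idx)).2 hvS
  · refine IsAtomicSet.of_range (a := g⁻¹ • v) ?_ ?_
    · rwa [MulAction.orbit_smul]
    · rw [hgv]
      rintro y (rfl | hy)
      · exact ⟨Fin.last _, by simp⟩
      · obtain ⟨i, rfl⟩ := hFa hy
        exact ⟨i.castSucc, by simp⟩

theorem definable_setOf_boundedFormula {k : ℕ} (φ : L.BoundedFormula Empty k) :
    (∅ : Set X).Definable L {v : Fin k → X | φ.Realize default v} := by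
  refine Set.empty_definable_iff.2 ⟨φ.toFormula.relabel (Sum.elim Empty.elim id), ?_⟩
  ext v
  simp only [Set.mem_ofPred_eq, Formula.realize_relabel, BoundedFormula.realize_toFormula]
  exact iff_of_eq (congrArg₂ _ (Subsingleton.elim _ _) rfl)

/-- There is an elementary substructure all of whose tuples have definable orbits. -/
theorem exists_atomic_elementarySubstructure [L.IsRelational] [Countable (Σ n, L.Relations n)]
    [Infinite X] (hcat : IsOmegaCategorical L X) (hhom : L.IsUltrahomogeneous X) :
    ∃ Y : L.ElementarySubstructure X, IsAtomicSet L (Y : Set X) := by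
  have := hcat.countable
  have : Countable L.Symbols := by unfold Language.Symbols; infer_instance
  let P := {F : Finset X // IsAtomicSet L (F : Set X)}
  let ι := Σ k : ℕ, L.BoundedFormula Empty (k + 1) × (Fin k → X)
  have hι : Countable ι := by
    have : ∀ k, Countable (L.BoundedFormula Empty k) := fun k => by
      have h1 : Countable (Σ n, L.BoundedFormula Empty n) := by
        refine Cardinal.mk_le_aleph0_iff.1 (BoundedFormula.card_le.trans ?_)
        simpa using card_le_aleph0
      exact (sigma_mk_injective (β := L.BoundedFormula Empty) (i := k)).countable
    infer_instance
  let _ : Encodable ι := Encodable.ofCountable ι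
  let S : ∀ i : ι, Set (Fin (i.1 + 1) → X) := fun i => {v | i.2.1.Realize default v}
  -- One Tarski–Vaught requirement per formula and parameter tuple. It is imposed only if some
  -- larger atomic set contains the parameters: this makes it cofinal, and in the directed union it
  -- is met by every tuple that occurs.
  let D : ι → Order.Cofinal P := fun i =>
    { carrier := {F | (∃ b, (Fin.snoc i.2.2 b : Fin (i.1 + 1) → X) ∈ S i) →
        (∃ F' : P, F ≤ F' ∧ ∀ j, i.2.2 j ∈ F'.1) →
        ∃ b ∈ F.1, (Fin.snoc i.2.2 b : Fin (i.1 + 1) → X) ∈ S i}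
      isCofinal := fun F => by
        classical
        by_cases h1 : ∃ b, (Fin.snoc i.2.2 b : Fin (i.1 + 1) → X) ∈ S i
        · by_cases h2 : ∃ F' : P, F ≤ F' ∧ ∀ j, i.2.2 j ∈ F'.1
          · obtain ⟨F', hFF', hF'⟩ := h2
            obtain ⟨b, hb, hb'⟩ := F'.2.exists_insert hcat hhom
              (definable_setOf_boundedFormula i.2.1) hF' h1
            refine ⟨⟨insert b F'.1, by simpa using hb'⟩, fun _ _ => ⟨b, by simp, hb⟩, ?_⟩
            exact le_trans (b := F'.1) hFF' (Finset.subset_insert _ _)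
          · exact ⟨F, fun _ h => absurd h h2, le_rfl⟩
        · exact ⟨F, fun h => absurd h h1, le_rfl⟩ }
  have hempty : IsAtomicSet L ((∅ : Finset X) : Set X) := by
    refine IsAtomicSet.of_range (n := 0) (a := Fin.elim0) ?_ (by simp)
    convert Set.definable_univ
    ext v
    simp only [Set.mem_univ, iff_true]
    exact ⟨1, Subsingleton.elim _ _⟩
  let I := Order.idealOfCofinals (⟨∅, hempty⟩ : P) D
  let Y : Set X := {y | ∃ F ∈ I, y ∈ F.1}
  have hfin : ∀ (k : ℕ) (a : Fin k → X), (∀ i, a i ∈ Y) → ∃ F ∈ I, ∀ i, a i ∈ F.1 := by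
    intro k a ha
    choose F hFI hF using ha
    obtain ⟨F', hF'⟩ : ∃ F' ∈ I, ∀ i ∈ (Finset.univ : Finset (Fin k)), F i ≤ F' := by
      refine Finset.induction_on (Finset.univ : Finset (Fin k))
        ⟨_, Order.mem_idealOfCofinals _ D, by simp⟩ ?_
      rintro i s - ⟨F', hF', h⟩
      obtain ⟨F'', h1, h2, h3⟩ := I.directed _ hF' _ (hFI i)
      refine ⟨F'', h1, fun j hj => ?_⟩
      rcases Finset.mem_insert.1 hj with rfl | hj
      · exact h3
      · exact (h j hj).trans h2
    exact ⟨F', hF'.1, fun i => hF'.2 i (Finset.mem_univ i) (hF i)⟩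
  have hY : (Substructure.closure L Y : Set X) = Y := Substructure.closure_eq_of_isRelational L _
  have hYmem : ∀ y, y ∈ Substructure.closure L Y ↔ y ∈ Y := fun y => by
    rw [← SetLike.mem_coe, hY]
  refine ⟨(Substructure.closure L Y).toElementarySubstructure fun k φ x a ha => ?_, ?_⟩
  · obtain ⟨F, hF, hxF⟩ := hfin k (fun i => x i) fun i => (hYmem _).1 (x i).2
    obtain ⟨F', hF', hF'I⟩ := Order.cofinal_meets_idealOfCofinals (⟨∅, hempty⟩ : P) D
      ⟨k, φ, fun i => x i⟩
    obtain ⟨F'', -, h1, h2⟩ := I.directed _ hF _ hF'I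
    obtain ⟨b, hb, hb'⟩ := hF' ⟨a, ha⟩ ⟨F'', h2, fun j => h1 (hxF j)⟩
    exact ⟨⟨b, (hYmem _).2 ⟨F', hF'I, hb⟩⟩, hb'⟩
  · intro k a ha
    obtain ⟨F, -, hF⟩ := hfin k a fun i => (hYmem _).1 (ha i)
    exact F.2 k a hF

/-- Every orbit of an `ω`-categorical ultrahomogeneous structure on tuples is definable. -/
theorem definable_orbit [L.IsRelational] [Countable (Σ n, L.Relations n)]
    [Infinite X] (hcat : IsOmegaCategorical L X) (hhom : L.IsUltrahomogeneous X) {n : ℕ}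
    (a : Fin n → X) : (∅ : Set X).Definable L (MulAction.orbit (Aut L X) a) := by
  have := hcat.countable
  obtain ⟨Y, hY⟩ := exists_atomic_elementarySubstructure hcat hhom
  have hYinf : Infinite Y := (Y.elementarilyEquivalent.infinite_iff).2 inferInstance
  have hYX : Y ⊨ L.completeTheory X := (Y.theory_model_iff _).2 inferInstance
  obtain ⟨e⟩ := hcat.categorical (Theory.ModelType.of _ X) (Theory.ModelType.of _ Y)
    (Cardinal.mk_eq_aleph0 X) (Cardinal.mk_eq_aleph0 Y)
  let e' : X ≃[L] Y := e
  have h := hY n (fun i => e' (a i)) fun i => (e' (a i)).2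
  obtain ⟨ψ, hψ⟩ := Set.empty_definable_iff.1 h
  -- `ψ` isolates the type of the image of `a` in `Y`; it passes down to `Y` by elementarity and
  -- back to `X` along the isomorphism, so `a` lies in that same orbit.
  have h1 : ψ.Realize (fun i => (e' (a i) : X)) := by
    have := MulAction.mem_orbit_self (M := Aut L X) (fun i => (e' (a i) : X))
    rw [hψ] at this
    exact this
  have h2 : ψ.Realize (fun i => e' (a i)) := (Y.subtype.map_formula ψ _).1 h1
  have h3 : ψ.Realize a := (StrongHomClass.realize_formula e' ψ).1 h2
  have h4 : a ∈ MulAction.orbit (Aut L X) (fun i => (e' (a i) : X)) := by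
    rw [hψ]; exact h3
  rwa [MulAction.orbit_eq_iff.2 h4]

/-- The automorphism group is oligomorphic. -/
theorem finite_orbits [L.IsRelational] [Countable (Σ n, L.Relations n)]
    [Infinite X] (hcat : IsOmegaCategorical L X) (hhom : L.IsUltrahomogeneous X) (n : ℕ) :
    ∃ s : Finset (Fin n → X), ∀ a, ∃ b ∈ s, ∃ g : Aut L X, g • b = a := by
  by_contra! hcon
  obtain ⟨a, ha⟩ := nonempty_iInter_of_definable hcat
    (fun b : Fin n → X => (MulAction.orbit (Aut L X) b)ᶜ)
    (fun b => (definable_orbit hcat hhom b).compl) fun s => by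
      obtain ⟨a, ha⟩ := hcon s
      exact ⟨a, Set.mem_iInter₂.2 fun b hb => fun ⟨g, hg⟩ => ha b hb g hg⟩
  exact Set.mem_iInter.1 ha a (MulAction.mem_orbit_self a)

/-- Sets of tuples invariant under automorphisms are definable. -/
theorem definable_of_invariant [L.IsRelational] [Countable (Σ n, L.Relations n)]
    [Infinite X] (hcat : IsOmegaCategorical L X) (hhom : L.IsUltrahomogeneous X) {n : ℕ}
    {S : Set (Fin n → X)} (hS : ∀ (g : Aut L X), ∀ a ∈ S, g • a ∈ S) :
    (∅ : Set X).Definable L S := by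
  classical
  obtain ⟨s, hs⟩ := finite_orbits hcat hhom n
  have : S = ⋃ b ∈ s.filter (· ∈ S), MulAction.orbit (Aut L X) b := by
    ext a
    simp only [Set.mem_iUnion, Finset.mem_filter, exists_prop]
    constructor
    · intro ha
      obtain ⟨b, hb, g, rfl⟩ := hs a
      refine ⟨b, ⟨hb, ?_⟩, ⟨g, rfl⟩⟩
      simpa using hS g⁻¹ _ ha
    · rintro ⟨b, ⟨-, hb⟩, g, rfl⟩
      exact hS g b hb
  rw [this]
  exact Set.definable_biUnion_finset (fun b => definable_orbit hcat hhom b) _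

end Oligomorphic

/-! ### Stabilizers of finite sets. -/

open FirstOrder FirstOrder.Language Cardinal

/-- The properties of the pointwise stabilizers of finite sets on which property (T) rests. -/
structure StabilizerCalculus (G : Type*) (X : Type*) [Group G] [TopologicalSpace G]
    [MulAction G X] [DecidableEq X] : Prop where
  exists_fixing_subset : ∀ U ∈ nhds (1 : G), ∃ F : Finset X,
    ∀ g ∈ fixingSubgroup G (F : Set X), g ∈ U
  fixing_inter_le : ∀ (A B : Finset X) (V : Subgroup G), fixingSubgroup G (A : Set X) ≤ V →
    fixingSubgroup G (B : Set X) ≤ V → fixingSubgroup G ((A ∩ B : Finset X) : Set X) ≤ V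
  fixing_le_of_finite_index : ∀ (A E : Finset X) (V : Subgroup G),
    fixingSubgroup G (E : Set X) ≤ V → ∀ s : Set G, s.Finite →
    (∀ g ∈ fixingSubgroup G (A : Set X), ∃ k ∈ s, k⁻¹ * g ∈ V) →
    fixingSubgroup G (A : Set X) ≤ V
  finite_range : ∀ (A : Finset X) (f : G → ℂ),
    (∀ g, ∀ h ∈ fixingSubgroup G (A : Set X), f (h * g) = f g ∧ f (g * h) = f g) →
    (Set.range f).Finite

section Stabilizers

variable {L : FirstOrder.Language.{u, v}} {X : Type w} [L.Structure X]

theorem definable_of_invariant_of_finite [L.IsRelational] [Countable (Σ n, L.Relations n)]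
    [Infinite X] (hcat : IsOmegaCategorical L X) (hhom : L.IsUltrahomogeneous X) {α : Type*}
    [Finite α] {S : Set (α → X)} (hS : ∀ (g : Aut L X), ∀ a ∈ S, g • a ∈ S) :
    (∅ : Set X).Definable L S := by
  obtain ⟨n, ⟨e⟩⟩ := Finite.exists_equiv_fin α
  have h := definable_of_invariant hcat hhom (S := {u : Fin n → X | u ∘ e ∈ S})
    fun g a ha => hS g _ ha
  convert h.preimage_comp e.symm using 1
  ext v
  simp [Function.comp_assoc]

/-- The orbit V·a of an enumeration `a` of `A` is an imaginary whose setwise stabilizer is `V`. Its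
finitely many codes are permuted by `V`, and fixing one code fixes the imaginary; so `C` collects
the entries of all codes. -/
theorem exists_finset_of_fixing_le [L.IsRelational] [Countable (Σ n, L.Relations n)]
    [Infinite X] (hcat : IsOmegaCategorical L X) (hhom : L.IsUltrahomogeneous X)
    (hwei : WeakElimImaginaries L X) (A : Finset X) (V : Subgroup (Aut L X))
    (hV : fixingSubgroup (Aut L X) (A : Set X) ≤ V) :
    ∃ C : Set X, C.Finite ∧ fixingSubgroup (Aut L X) C ≤ V ∧ ∀ g ∈ V, ∀ c ∈ C, g • c ∈ C := by
  let m := A.card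
  let a : Fin m → X := fun i => A.equivFin.symm i
  have hfix : ∀ g : Aut L X, g • a = a → g ∈ V := fun g hg => by
    refine hV ((mem_fixingSubgroup_iff _).2 fun y hy => ?_)
    have := congrFun hg (A.equivFin ⟨y, hy⟩)
    simpa [a] using this
  let S : Set (Fin m → X) := MulAction.orbit (Aut L X) a
  let r : (Fin m → X) → (Fin m → X) → Prop := fun v w =>
    ∃ g : Aut L X, ∃ h ∈ V, g • a = v ∧ (g * h) • a = w
  have hrinv : ∀ (g : Aut L X) v w, r v w → r (g • v) (g • w) := by
    rintro g _ _ ⟨k, h, hh, rfl, rfl⟩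
    exact ⟨g * k, h, hh, mul_smul _ _ _, by rw [mul_assoc, mul_smul]⟩
  let θ : Setoid S :=
    { r := fun v w => r v w
      iseqv :=
        { refl := by
            rintro ⟨_, g, rfl⟩
            exact ⟨g, 1, V.one_mem, rfl, by rw [mul_one]⟩
          symm := by
            rintro ⟨v, _⟩ ⟨w, _⟩ ⟨g, h, hh, h1, h2⟩
            exact ⟨g * h, h⁻¹, V.inv_mem hh, h2, by rwa [mul_inv_cancel_right]⟩
          trans := by
            rintro ⟨v, _⟩ ⟨w, _⟩ ⟨x, _⟩ ⟨g, h, hh, h1, h2⟩ ⟨g', h', hh', h1', h2'⟩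
            -- Both `g * h` and `g'` send `a` to the middle tuple, so their quotient fixes `a` and
            -- lies in `V`.
            refine ⟨g, h * ((g * h)⁻¹ * g') * h', V.mul_mem (V.mul_mem hh (hfix _ ?_)) hh', h1, ?_⟩
            · rw [mul_smul, inv_smul_eq_iff]
              exact h1'.trans h2.symm
            · rw [← h2']
              congr 1
              group } }
  have himag : IsImaginary L {v : Fin m → X | ∃ h ∈ V, h • a = v} := by
    refine ⟨S, θ, definable_orbit hcat hhom a, ?_, ⟨a, MulAction.mem_orbit_self a⟩, ?_⟩
    · refine definable_of_invariant_of_finite hcat hhom ?_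
      rintro g v ⟨h1, h2, h3⟩
      exact ⟨MulAction.mem_orbit_of_mem_orbit g h1, MulAction.mem_orbit_of_mem_orbit g h2,
        hrinv g _ _ h3⟩
    · ext v
      constructor
      · rintro ⟨h, hh, rfl⟩
        exact ⟨⟨h, rfl⟩, h, h⁻¹, V.inv_mem hh, rfl, by rw [mul_inv_cancel, one_smul]⟩
      · rintro ⟨_, g, h, hh, h1, h2⟩
        refine ⟨g, ?_, h1⟩
        have := V.mul_mem (hfix (g * h) h2) (V.inv_mem hh)
        rwa [mul_inv_cancel_right] at this
  obtain ⟨n, φ, hfin, c₀, hc₀⟩ := hwei m _ himag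
  have hφ : ∀ (g : Aut L X) (x : Fin m → X) (c : Fin n → X),
      φ.Realize (Sum.elim (g • x) (g • c)) ↔ φ.Realize (Sum.elim x c) := fun g x c => by
    have := StrongHomClass.realize_formula g φ (v := Sum.elim x c)
    rwa [Sum.comp_elim] at this
  have hmem : ∀ c ∈ codes L φ {v : Fin m → X | ∃ h ∈ V, h • a = v}, ∀ x,
      φ.Realize (Sum.elim x c) ↔ ∃ h ∈ V, h • a = x := fun c hc x =>
    (Set.ext_iff.1 hc x).symm
  refine ⟨⋃ c ∈ codes L φ {v : Fin m → X | ∃ h ∈ V, h • a = v}, Set.range c,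
    hfin.biUnion fun c _ => Set.finite_range c, fun g hg => ?_, ?_⟩
  · rw [mem_fixingSubgroup_iff] at hg
    have hgc : g • c₀ = c₀ := funext fun i => hg _ (Set.mem_biUnion hc₀ ⟨i, rfl⟩)
    have h1 := (hmem c₀ hc₀ a).2 ⟨1, V.one_mem, one_smul _ _⟩
    rw [← hφ g, hgc] at h1
    obtain ⟨h, hh, h2⟩ := (hmem c₀ hc₀ _).1 h1
    have h3 := hfix (h⁻¹ * g) (by rw [mul_smul, inv_smul_eq_iff]; exact h2.symm)
    simpa using V.mul_mem hh h3
  · intro g hg c hc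
    obtain ⟨d, hd, i, rfl⟩ := Set.mem_iUnion₂.1 hc
    refine Set.mem_biUnion (x := g • d) ?_ ⟨i, rfl⟩
    refine Set.ext fun x => ?_
    change (∃ h ∈ V, h • a = x) ↔ φ.Realize (Sum.elim x (g • d))
    rw [← smul_inv_smul g x, hφ, hmem d hd]
    constructor
    · rintro ⟨h, hh, h1⟩
      exact ⟨g⁻¹ * h, V.mul_mem (V.inv_mem hg) hh, by rw [mul_smul, h1, inv_smul_smul]⟩
    · rintro ⟨h, hh, h1⟩
      exact ⟨g * h, V.mul_mem hg hh, by rw [mul_smul, h1]⟩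

theorem NoAlgebraicity.mem_of_finite_orbit [L.IsRelational] (halg : NoAlgebraicity L X)
    (A : Finset X) {b : X}
    (hb : (MulAction.orbit (fixingSubgroup (Aut L X) (A : Set X)) b).Finite) : b ∈ A := by
  have hA : (Substructure.closure L (A : Set X) : Set X) = A :=
    Substructure.closure_eq_of_isRelational L _
  have := halg (Substructure.closure L (A : Set X)) (by rw [hA]; exact A.finite_toSet)
  rw [hA] at this
  have h : b ∈ algClosure L X (A : Set X) := hb
  rw [this] at h
  exact h

/-- Points can be moved off any finite set by automorphisms fixing a finite set without them. -/
theorem NoAlgebraicity.exists_smul_notMem [L.IsRelational] (halg : NoAlgebraicity L X)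
    (A F : Finset X) {b : X} (hb : b ∉ A) :
    ∃ g ∈ fixingSubgroup (Aut L X) (A : Set X), g • b ∉ F := by
  by_contra! hcon
  refine hb (halg.mem_of_finite_orbit A (F.finite_toSet.subset ?_))
  rintro _ ⟨g, rfl⟩
  exact hcon g g.2

theorem stabilizerCalculus [L.IsRelational] [Countable (Σ n, L.Relations n)] [DecidableEq X]
    [Infinite X] (hcat : IsOmegaCategorical L X) (hhom : L.IsUltrahomogeneous X)
    (halg : NoAlgebraicity L X) (hwei : WeakElimImaginaries L X) :
    StabilizerCalculus (Aut L X) X where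
  exists_fixing_subset U hU := by
    let _ : TopologicalSpace X := ⊥
    have _ : DiscreteTopology X := ⟨rfl⟩
    rw [nhds_induced, Filter.mem_comap] at hU
    obtain ⟨W, hW, hWU⟩ := hU
    rw [nhds_pi, Filter.mem_pi] at hW
    obtain ⟨I, hI, t, ht, htW⟩ := hW
    refine ⟨hI.toFinset, fun g hg => hWU (htW fun i hi => ?_)⟩
    have h1 : g i = i := (mem_fixingSubgroup_iff _).1 hg i (by simpa using hi)
    change g i ∈ t i
    rw [h1]
    exact mem_of_mem_nhds (ht i)
  fixing_inter_le A B V hA hB := by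
    obtain ⟨C, hC, hCV, hVC⟩ := exists_finset_of_fixing_le hcat hhom hwei A V hA
    -- Elements of `V` keep `c` in the finite set `C`, so its orbit under the stabilizer of `D` is
    -- finite and no algebraicity applies.
    have key : ∀ D : Finset X, fixingSubgroup (Aut L X) (D : Set X) ≤ V → ∀ c ∈ C, c ∈ D :=
      fun D hD c hc => halg.mem_of_finite_orbit D <| hC.subset <| by
        rintro _ ⟨g, rfl⟩
        exact hVC g (hD g.2) c hc
    refine (fixingSubgroup_antitone _ _ fun c hc => ?_).trans hCV
    simpa using ⟨key A hA c hc, key B hB c hc⟩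
  fixing_le_of_finite_index A E V hE s hs hAV := by
    obtain ⟨C, hC, hCV, hVC⟩ := exists_finset_of_fixing_le hcat hhom hwei E V hE
    refine (fixingSubgroup_antitone _ _ fun c hc => ?_).trans hCV
    refine halg.mem_of_finite_orbit A
      ((hs.biUnion fun k _ => hC.image fun x => k • x).subset ?_)
    rintro _ ⟨g, rfl⟩
    obtain ⟨k, hk, hkV⟩ := hAV g g.2
    refine Set.mem_biUnion hk ⟨_, hVC _ hkV c hc, ?_⟩
    change k • (k⁻¹ * (g : Aut L X)) • c = (g : Aut L X) • c
    rw [mul_smul, smul_inv_smul]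
  finite_range A f hf := by
    let a : Fin A.card → X := fun i => A.equivFin.symm i
    have hfix : ∀ g : Aut L X, g • a = a → g ∈ fixingSubgroup (Aut L X) (A : Set X) :=
      fun g hg => by
        refine (mem_fixingSubgroup_iff _).2 fun y hy => ?_
        have := congrFun hg (A.equivFin ⟨y, hy⟩)
        simpa [a] using this
    obtain ⟨s, hs⟩ := finite_orbits hcat hhom (A.card + A.card)
    choose rep hrep k hk using fun g : Aut L X => hs (Fin.append a (g • a))
    -- The double coset of `g` is determined by the orbit of the pair (a, g • a), and oligomorphy
    -- leaves finitely many such orbits.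
    have hfac : Function.FactorsThrough f fun g => (⟨rep g, hrep g⟩ : s) := by
      intro g g' hgg'
      have h1 : rep g = rep g' := congrArg Subtype.val hgg'
      let l := k g' * (k g)⁻¹
      have h2 : l • Fin.append a (g • a) = Fin.append a (g' • a) := by
        rw [← hk g, ← hk g', mul_smul, inv_smul_smul, h1]
      have h3 : l • a = a := funext fun i => by
        have := congrFun h2 (Fin.castAdd _ i)
        simpa using this
      have h4 : (l * g) • a = g' • a := funext fun i => by
        have := congrFun h2 (Fin.natAdd _ i)
        simp only [Pi.smul_apply, Fin.append_right] at this
        rwa [← mul_smul] at this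
      have h5 := hfix (g'⁻¹ * (l * g)) (by rw [mul_smul, inv_smul_eq_iff]; exact h4)
      have h6 := (hf g' _ h5).2
      rw [mul_inv_cancel_left, (hf g l (hfix l h3)).1] at h6
      exact h6
    obtain ⟨e, he⟩ := (Function.factorsThrough_iff f).1 hfac
    rw [he]
    exact (Set.finite_range e).subset (Set.range_comp_subset_range _ e)

end Stabilizers

/-! ### A generic ping-pong pair. -/

open FirstOrder FirstOrder.Language Cardinal

section PingPong

variable (L : FirstOrder.Language.{u, v}) (X : Type w) [L.Structure X]

/-- A finite approximation of a pair of automorphisms together with a ping-pong colouring: the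
automorphism `map i` matters only on `dom i`, and the colouring only on `supp`. -/
structure PingPongApprox where
  map : Bool → Aut L X
  dom : Bool → Finset X
  supp : Finset X
  colour : X → Bool × Bool
  dom_subset : ∀ i, ∀ x ∈ dom i, x ∈ supp ∧ map i x ∈ supp
  colour_map : ∀ i, ∀ x ∈ dom i, colour x ≠ (i, false) → colour (map i x) = (i, true)

variable {L X}

instance : Preorder (PingPongApprox L X) where
  le p q := (∀ i, ∀ x ∈ p.dom i, x ∈ q.dom i ∧ q.map i x = p.map i x) ∧
    ∀ x ∈ p.supp, x ∈ q.supp ∧ q.colour x = p.colour x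
  le_refl p := ⟨fun _ _ h => ⟨h, rfl⟩, fun _ h => ⟨h, rfl⟩⟩
  le_trans p q r h1 h2 := ⟨fun i x hx => ⟨(h2.1 i x (h1.1 i x hx).1).1,
    (h2.1 i x (h1.1 i x hx).1).2.trans (h1.1 i x hx).2⟩,
    fun x hx => ⟨(h2.2 x (h1.2 x hx).1).1, (h2.2 x (h1.2 x hx).1).2.trans (h1.2 x hx).2⟩⟩

/-- Extension of an approximation by one pair of points, one of which is new. -/
theorem PingPongApprox.exists_extend [DecidableEq X] (p : PingPongApprox L X) (i : Bool)
    (γ : Aut L X) (hγ : ∀ x ∈ p.dom i, γ x = p.map i x) (x : X) (n : X) (ε : Bool)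
    (hn : n ∉ p.supp) (hne : x ≠ γ x) (hnx : n = if ε then γ x else x) :
    ∃ q, p ≤ q ∧ x ∈ q.dom i ∧ q.map i x = γ x := by
  -- The new point is free to be coloured: a new image receives the target colour (i, true), while a
  -- new source receives the exempt colour (i, false).
  have hcol : ∀ y ∈ p.supp, Function.update p.colour n (i, ε) y = p.colour y := fun y hy =>
    Function.update_of_ne (fun h : y = n => hn (h ▸ hy)) _ _
  refine ⟨{ map := Function.update p.map i γ
            dom := Function.update p.dom i (insert x (p.dom i))
            supp := insert x (insert (γ x) p.supp)
            colour := Function.update p.colour n (i, ε)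
            dom_subset := fun j y hy => ?_
            colour_map := fun j y hy => ?_ }, ⟨fun j y hy => ?_, fun y hy => ?_⟩, ?_, ?_⟩
  · by_cases hj : j = i
    · subst hj
      simp only [Function.update_self, Finset.mem_insert] at hy ⊢
      rcases hy with rfl | hy
      · simp
      · rw [hγ y hy]
        have := p.dom_subset j y hy
        tauto
    · simp only [Function.update_of_ne hj, Finset.mem_insert] at hy ⊢
      have := p.dom_subset j y hy
      tauto
  · by_cases hj : j = i
    · subst hj
      simp only [Function.update_self, Finset.mem_insert] at hy ⊢
      rcases hy with rfl | hy
      · cases ε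
        · simp only [Bool.false_eq_true, if_false] at hnx
          subst hnx
          simp
        · simp only [if_true] at hnx
          subst hnx
          simp
      · rw [hγ y hy, hcol _ (p.dom_subset j y hy).1, hcol _ (p.dom_subset j y hy).2]
        exact p.colour_map j y hy
    · simp only [Function.update_of_ne hj] at hy ⊢
      rw [hcol _ (p.dom_subset j y hy).1, hcol _ (p.dom_subset j y hy).2]
      exact p.colour_map j y hy
  · by_cases hj : j = i
    · subst hj
      simp [hy, hγ y hy]
    · simp [Function.update_of_ne hj, hy]
  · exact ⟨by simp [hy], hcol y hy⟩
  · simp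
  · simp

/-- No algebraicity lets the image of `x` be moved to an uncoloured point without disturbing the
images already prescribed. -/
theorem PingPongApprox.exists_dom [L.IsRelational] (halg : NoAlgebraicity L X)
    (p : PingPongApprox L X) (i : Bool) (x : X) : ∃ q, p ≤ q ∧ x ∈ q.dom i := by
  classical
  by_cases hx : x ∈ p.dom i
  · exact ⟨p, le_rfl, hx⟩
  obtain ⟨h, hh, hhx⟩ := halg.exists_smul_notMem ((p.dom i).image (p.map i)) (insert x p.supp)
    (b := p.map i x) (by
      simp only [Finset.mem_image, not_exists, not_and]
      intro y hy hyx
      exact hx ((p.map i).injective hyx ▸ hy))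
  rw [mem_fixingSubgroup_iff] at hh
  simp only [Finset.mem_insert, not_or] at hhx
  obtain ⟨q, hq, hxq, -⟩ := p.exists_extend i (h * p.map i)
    (fun y hy => hh _ (Finset.mem_coe.2 (Finset.mem_image_of_mem _ hy))) x (h • p.map i x) true
    hhx.2
    (fun h' => hhx.1 h'.symm) rfl
  exact ⟨q, hq, hxq⟩

theorem PingPongApprox.exists_range [L.IsRelational] (halg : NoAlgebraicity L X)
    (p : PingPongApprox L X) (i : Bool) (y : X) :
    ∃ q, p ≤ q ∧ ∃ x ∈ q.dom i, q.map i x = y := by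
  classical
  by_cases hy : ∃ x ∈ p.dom i, p.map i x = y
  · exact ⟨p, le_rfl, hy⟩
  obtain ⟨h, hh, hhx⟩ := halg.exists_smul_notMem (p.dom i) (insert y p.supp)
    (b := (p.map i)⁻¹ • y) (fun hmem => hy ⟨_, hmem, smul_inv_smul (p.map i) y⟩)
  rw [mem_fixingSubgroup_iff] at hh
  simp only [Finset.mem_insert, not_or] at hhx
  have h1 : (p.map i * h⁻¹) • h • (p.map i)⁻¹ • y = y := by
    rw [mul_smul, inv_smul_smul, smul_inv_smul]
  obtain ⟨q, hq, hxq, hqx⟩ := p.exists_extend i (p.map i * h⁻¹)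
    (fun x hx => by
      have : h⁻¹ • x = x := by rw [inv_smul_eq_iff, hh x hx]
      exact congrArg (p.map i) this)
    (h • (p.map i)⁻¹ • y) _ false hhx.2 (fun h' => hhx.1 (h'.trans h1)) rfl
  exact ⟨q, hq, _, hxq, hqx.trans h1⟩

/-- There are two automorphisms playing ping-pong on the points of a structure without
algebraicity. -/
theorem exists_pingPong [L.IsRelational] [Countable X] (halg : NoAlgebraicity L X) :
    ∃ (g : Bool → Aut L X) (c : X → Bool × Bool),
      ∀ i x, c x ≠ (i, false) → c (g i • x) = (i, true) := by
  classical
  let _ : Encodable X := Encodable.ofCountable X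
  let D : (Bool × X) ⊕ (Bool × X) → Order.Cofinal (PingPongApprox L X) := fun t => match t with
    | .inl (i, x) =>
      { carrier := {q | x ∈ q.dom i}
        isCofinal := fun p => by
          obtain ⟨q, hq, h⟩ := p.exists_dom halg i x
          exact ⟨q, h, hq⟩ }
    | .inr (i, y) =>
      { carrier := {q | ∃ x ∈ q.dom i, q.map i x = y}
        isCofinal := fun p => by
          obtain ⟨q, hq, h⟩ := p.exists_range halg i y
          exact ⟨q, h, hq⟩ }
  let p₀ : PingPongApprox L X :=
    { map := fun _ => 1, dom := fun _ => ∅, supp := ∅, colour := fun _ => (true, true)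
      dom_subset := by simp
      colour_map := by simp }
  let I := Order.idealOfCofinals p₀ D
  have hdom : ∀ i x, ∃ q ∈ I, x ∈ q.dom i := fun i x => by
    obtain ⟨q, h1, h2⟩ := Order.cofinal_meets_idealOfCofinals p₀ D (.inl (i, x))
    exact ⟨q, h2, h1⟩
  have hran : ∀ i y, ∃ q ∈ I, ∃ x ∈ q.dom i, q.map i x = y := fun i y => by
    obtain ⟨q, h1, h2⟩ := Order.cofinal_meets_idealOfCofinals p₀ D (.inr (i, y))
    exact ⟨q, h2, h1⟩
  choose q hqI hq using hdom
  have hfin : ∀ i (s : Finset X), ∃ r ∈ I, ∀ x ∈ s, x ∈ r.dom i ∧ r.map i x = (q i x).map i x := by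
    intro i s
    refine Finset.induction_on s ⟨p₀, Order.mem_idealOfCofinals _ _, by simp⟩ ?_
    rintro x s - ⟨r, hr, h⟩
    obtain ⟨r', h1, h2, h3⟩ := I.directed _ hr _ (hqI i x)
    refine ⟨r', h1, fun y hy => ?_⟩
    rcases Finset.mem_insert.1 hy with rfl | hy
    · exact h3.1 i y (hq i y)
    · have h4 := h2.1 i y (h y hy).1
      exact ⟨h4.1, h4.2.trans (h y hy).2⟩
  have hmap : ∀ i, ∀ r ∈ I, ∀ x ∈ r.dom i, r.map i x = (q i x).map i x := fun i r hr x hx => by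
    obtain ⟨r', h1, h2, h3⟩ := I.directed _ hr _ (hqI i x)
    rw [← (h2.1 i x hx).2, (h3.1 i x (hq i x)).2]
  have hbij : ∀ i, Function.Bijective fun x => (q i x).map i x := by
    refine fun i => ⟨fun x y hxy => ?_, fun y => ?_⟩
    · obtain ⟨r, -, hr⟩ := hfin i {x, y}
      have h1 := (hr x (by simp)).2
      have h2 := (hr y (by simp)).2
      exact (r.map i).injective (h1.trans (hxy.trans h2.symm))
    · obtain ⟨r, hr, x, hx, rfl⟩ := hran i y
      exact ⟨x, (hmap i r hr x hx).symm⟩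
  let g : Bool → Aut L X := fun i =>
    { toEquiv := Equiv.ofBijective _ (hbij i)
      map_fun' := fun {k} F => isEmptyElim F
      map_rel' := fun {k} R x => by
        obtain ⟨r, -, hr⟩ := hfin i (Finset.univ.image x)
        have h1 : (fun j => (q i (x j)).map i (x j)) = r.map i ∘ x :=
          funext fun j => (hr (x j) (by simp)).2.symm
        change Structure.RelMap R (fun j => (q i (x j)).map i (x j)) ↔ _
        rw [h1]
        exact (r.map i).map_rel R x }
  -- The index `true` is arbitrary: by directedness all approximations in `I` that see `x` agree on
  -- its colour.
  have hcol : ∀ r ∈ I, ∀ x ∈ r.supp, (q true x).colour x = r.colour x := fun r hr x hx => by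
    obtain ⟨r', h1, h2, h3⟩ := I.directed _ hr _ (hqI true x)
    rw [← (h2.2 x hx).2, ← (h3.2 x ((q true x).dom_subset true x (hq true x)).1).2]
  refine ⟨g, fun x => (q true x).colour x, fun i x hx => ?_⟩
  have hs := (q i x).dom_subset i x (hq i x)
  change (q true ((q i x).map i x)).colour ((q i x).map i x) = _
  rw [hcol _ (hqI i x) _ hs.2]
  simp only [hcol _ (hqI i x) _ hs.1] at hx
  exact (q i x).colour_map i x (hq i x) hx

end PingPong

/-! ### Weak limits in Hilbert space. -/

section WeakClosure

open Filter Topology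
open scoped ComplexInnerProductSpace

variable {H : Type*} [NormedAddCommGroup H] [InnerProductSpace ℂ H]

variable (H) in
/-- The weak topology of an inner product space. -/
noncomputable abbrev weakTopology : TopologicalSpace H :=
  TopologicalSpace.induced (fun (x y : H) => ⟪x, y⟫) Pi.topologicalSpace

/-- The closure of a set in the weak topology. -/
def weakClosure (O : Set H) : Set H := @closure H (weakTopology H) O

theorem mem_weakClosure_iff {O : Set H} {w : H} : w ∈ weakClosure O ↔
    ∃ U : Ultrafilter H, O ∈ U ∧ ∀ y, Tendsto (fun x : H => ⟪x, y⟫) U (𝓝 ⟪w, y⟫) := by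
  let τ := weakTopology H
  refine (@mem_closure_iff_ultrafilter H w O τ).trans (exists_congr fun U => and_congr Iff.rfl ?_)
  rw [@nhds_induced, ← tendsto_iff_comap, tendsto_pi_nhds]

theorem subset_weakClosure (O : Set H) : O ⊆ weakClosure O := @subset_closure H (weakTopology H) O

theorem weakClosure_subset_of_subset {O O' : Set H} (h : O ⊆ weakClosure O') :
    weakClosure O ⊆ weakClosure O' :=
  @closure_minimal H (weakTopology H) O (weakClosure O') h (@isClosed_closure H (weakTopology H) O')

theorem weakClosure_image_subset {O : Set H} (e : H ≃ₗᵢ[ℂ] H) {w : H} (hw : w ∈ weakClosure O) :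
    e w ∈ weakClosure (e '' O) := by
  obtain ⟨U, hU, h⟩ := mem_weakClosure_iff.1 hw
  refine mem_weakClosure_iff.2 ⟨U.map e, ?_, fun y => ?_⟩
  · exact Ultrafilter.mem_map.2 (Filter.mem_of_superset hU (Set.subset_preimage_image e O))
  · rw [Ultrafilter.coe_map, tendsto_map'_iff]
    have := h (e.symm y)
    have he : ∀ x, ⟪e x, y⟫ = ⟪x, e.symm y⟫ := fun x => by
      rw [← e.inner_map_map x, e.apply_symm_apply]
    simpa only [Function.comp_def, he] using this

theorem norm_le_of_tendsto_inner {ι : Type*} {l : Filter ι} [l.NeBot] {v : ι → H} {w : H} {C : ℝ}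
    (hC : ∀ᶠ i in l, ‖v i‖ ≤ C) (h : ∀ y, Tendsto (fun i => ⟪v i, y⟫) l (𝓝 ⟪w, y⟫)) : ‖w‖ ≤ C := by
  have h1 : ‖⟪w, w⟫‖ ≤ C * ‖w‖ := by
    refine le_of_tendsto (h w).norm (hC.mono fun i hi => ?_)
    exact (norm_inner_le_norm _ _).trans (by gcongr)
  rw [inner_self_eq_norm_sq_to_K] at h1
  simp only [norm_pow, RCLike.norm_ofReal, abs_norm] at h1
  by_contra! hlt
  have hC0 : 0 ≤ C := by
    obtain ⟨i, hi⟩ := hC.exists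
    exact (norm_nonneg _).trans hi
  nlinarith [norm_nonneg w]

/-- Bounded ultrafilters in a Hilbert space converge weakly. -/
theorem exists_tendsto_inner [CompleteSpace H] {ι : Type*} (U : Ultrafilter ι) {v : ι → H} {C : ℝ}
    (hC : ∀ᶠ i in (U : Filter ι), ‖v i‖ ≤ C) :
    ∃ w, ∀ y, Tendsto (fun i => ⟪v i, y⟫) U (𝓝 ⟪w, y⟫) := by
  have hC0 : 0 ≤ C := by
    obtain ⟨i, hi⟩ := hC.exists
    exact (norm_nonneg _).trans hi
  have hlim : ∀ y : H, ∃ ℓ : ℂ, ‖ℓ‖ ≤ C * ‖y‖ ∧ Tendsto (fun i => ⟪v i, y⟫) U (𝓝 ℓ) := by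
    intro y
    obtain ⟨ℓ, hℓ, h⟩ := (isCompact_closedBall (0 : ℂ) (C * ‖y‖)).ultrafilter_le_nhds'
      (U.map fun i => ⟪v i, y⟫) (hC.mono fun i hi => by
        simp only [mem_closedBall_zero_iff]
        exact (norm_inner_le_norm _ _).trans (by gcongr))
    exact ⟨ℓ, by simpa using hℓ, h⟩
  choose ℓ hℓ hlim using hlim
  let f : H →ₗ[ℂ] ℂ :=
    { toFun := ℓ
      map_add' := fun x y => tendsto_nhds_unique (hlim (x + y)) <| by
        simpa only [inner_add_right] using (hlim x).add (hlim y)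
      map_smul' := fun c x => tendsto_nhds_unique (hlim (c • x)) <| by
        simpa only [inner_smul_right, RingHom.id_apply, smul_eq_mul] using (hlim x).const_mul c }
  let F : StrongDual ℂ H := f.mkContinuous C hℓ
  refine ⟨(InnerProductSpace.toDual ℂ H).symm F, fun y => ?_⟩
  rw [InnerProductSpace.toDual_symm_apply]
  exact hlim y

/-- The weak closure of a nonempty set has an element of minimal norm. -/
theorem exists_mem_weakClosure_norm_le [CompleteSpace H] {O : Set H} (hne : O.Nonempty) :
    ∃ w ∈ weakClosure O, ∀ x ∈ weakClosure O, ‖w‖ ≤ ‖x‖ := by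
  let N : Set ℝ := norm '' weakClosure O
  have hNne : N.Nonempty := (hne.mono (subset_weakClosure O)).image _
  have hbdd : BddBelow N := ⟨0, by rintro _ ⟨x, -, rfl⟩; exact norm_nonneg x⟩
  have hseq : ∀ n : ℕ, ∃ x ∈ weakClosure O, ‖x‖ < sInf N + 1 / (n + 1 : ℝ) := fun n => by
    obtain ⟨_, ⟨x, hx, rfl⟩, h⟩ := exists_lt_of_csInf_lt hNne
      (lt_add_of_pos_right (sInf N) (Nat.one_div_pos_of_nat (n := n)))
    exact ⟨x, hx, h⟩
  choose x hx hxn using hseq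
  have hle : ∀ n : ℕ, ∀ᶠ i in (hyperfilter ℕ : Filter ℕ), ‖x i‖ ≤ sInf N + 1 / (n + 1 : ℝ) := by
    intro n
    have hev : ∀ᶠ i : ℕ in (hyperfilter ℕ : Filter ℕ), n ≤ i :=
      Nat.hyperfilter_le_atTop (eventually_ge_atTop n)
    refine hev.mono fun i hi => ?_
    refine (hxn i).le.trans ?_
    have : (n : ℝ) ≤ i := by exact_mod_cast hi
    gcongr
  obtain ⟨w, hw⟩ := exists_tendsto_inner (hyperfilter ℕ) (hle 0)
  refine ⟨w, ?_, fun y hy => ?_⟩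
  · refine weakClosure_subset_of_subset (O := weakClosure O) subset_rfl
      (mem_weakClosure_iff.2 ⟨(hyperfilter ℕ).map x, ?_, fun y => ?_⟩)
    · exact Ultrafilter.mem_map.2 (Filter.univ_mem' hx)
    · rw [Ultrafilter.coe_map, tendsto_map'_iff]
      exact hw y
  · have h1 : ‖w‖ ≤ sInf N := by
      refine le_of_forall_pos_le_add fun ε hε => ?_
      obtain ⟨n, hn⟩ := exists_nat_one_div_lt hε
      exact (norm_le_of_tendsto_inner (hle n) hw).trans (by gcongr)
    exact h1.trans (csInf_le hbdd ⟨y, hy, rfl⟩)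

/-- On a sphere, weak convergence is norm convergence. -/
theorem tendsto_of_tendsto_inner_of_norm {ι : Type*} {l : Filter ι} {v : ι → H} {w : H}
    (hv : ∀ᶠ i in l, ‖v i‖ = ‖w‖) (h : ∀ y, Tendsto (fun i => ⟪v i, y⟫) l (𝓝 ⟪w, y⟫)) :
    Tendsto v l (𝓝 w) := by
  rw [tendsto_iff_norm_sub_tendsto_zero]
  have h1 : Tendsto (fun i => ‖w‖ ^ 2 - 2 * (⟪v i, w⟫).re + ‖w‖ ^ 2) l
      (𝓝 (‖w‖ ^ 2 - 2 * (⟪w, w⟫).re + ‖w‖ ^ 2)) :=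
    (((Complex.continuous_re.tendsto _).comp (h w)).const_mul 2 |>.const_sub _).add_const _
  have h2 : ‖w‖ ^ 2 - 2 * (⟪w, w⟫).re + ‖w‖ ^ 2 = 0 := by
    have := inner_self_eq_norm_sq (𝕜 := ℂ) w
    simp only [RCLike.re_to_complex] at this
    rw [this]; ring
  rw [h2] at h1
  have h3 : Tendsto (fun i => ‖v i - w‖ ^ 2) l (𝓝 0) := by
    refine h1.congr' (hv.mono fun i hi => ?_)
    have := norm_sub_sq (𝕜 := ℂ) (v i) w
    rw [hi] at this
    exact this.symm
  simpa using h3.sqrt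

/-- A subset of a sphere whose weak closure contains no shorter vectors is totally bounded. -/
theorem totallyBounded_of_norm_le_weakClosure [CompleteSpace H] {O : Set H} {r : ℝ}
    (hO : ∀ x ∈ O, ‖x‖ = r) (hr : ∀ x ∈ weakClosure O, r ≤ ‖x‖) : TotallyBounded O := by
  refine totallyBounded_iff_ultrafilter.2 fun U hU => ?_
  have hOU : O ∈ U := le_principal_iff.1 hU
  have hle : ∀ᶠ x in (U : Filter H), ‖id x‖ ≤ r :=
    Filter.mem_of_superset hOU fun x hx => (hO x hx).le
  obtain ⟨w, hw⟩ := exists_tendsto_inner U hle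
  have hwO : w ∈ weakClosure O := mem_weakClosure_iff.2 ⟨U, hOU, hw⟩
  have hwr : ‖w‖ = r := (norm_le_of_tendsto_inner hle hw).antisymm (hr w hwO)
  have : Tendsto id (U : Filter H) (𝓝 w) := tendsto_of_tendsto_inner_of_norm
    (Filter.mem_of_superset hOU fun x hx => (hO x hx).trans hwr.symm) hw
  exact cauchy_nhds.mono this

end WeakClosure

/-! ### Fixed vectors and their projections. -/

section Fixed

open Filter Topology
open scoped ComplexInnerProductSpace

variable {G : Type*} [Group G] [TopologicalSpace G] {H : Type*} [NormedAddCommGroup H]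
  [InnerProductSpace ℂ H]

namespace UnitaryRep

variable (π : UnitaryRep G H)

theorem map_mul_apply (g h : G) (ξ : H) : π.toHom (g * h) ξ = π.toHom g (π.toHom h ξ) := by
  rw [map_mul]; rfl

theorem map_one_apply (ξ : H) : π.toHom 1 ξ = ξ := by
  rw [map_one]; rfl

theorem map_inv_map (g : G) (ξ : H) : π.toHom g⁻¹ (π.toHom g ξ) = ξ := by
  rw [← map_mul_apply, inv_mul_cancel, map_one_apply]

theorem map_map_inv (g : G) (ξ : H) : π.toHom g (π.toHom g⁻¹ ξ) = ξ := by
  rw [← map_mul_apply, mul_inv_cancel, map_one_apply]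

theorem inner_map_left (g : G) (ξ η : H) : ⟪π.toHom g ξ, η⟫ = ⟪ξ, π.toHom g⁻¹ η⟫ := by
  rw [← (π.toHom g).inner_map_map ξ, map_map_inv]

/-- The subspace of vectors fixed by a subgroup. -/
def fixed (K : Subgroup G) : Submodule ℂ H where
  carrier := {ξ | ∀ g ∈ K, π.toHom g ξ = ξ}
  add_mem' := fun ha hb g hg => by rw [map_add, ha g hg, hb g hg]
  zero_mem' := fun g _ => map_zero _
  smul_mem' := fun c ξ h g hg => by rw [map_smul, h g hg]

variable {π} in
theorem mem_fixed {K : Subgroup G} {ξ : H} : ξ ∈ π.fixed K ↔ ∀ g ∈ K, π.toHom g ξ = ξ := Iff.rfl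

theorem fixed_anti {K K' : Subgroup G} (h : K ≤ K') : π.fixed K' ≤ π.fixed K :=
  fun _ hξ g hg => hξ g (h hg)

theorem isClosed_fixed (K : Subgroup G) : IsClosed (π.fixed K : Set H) := by
  have : (π.fixed K : Set H) = ⋂ g ∈ K, {ξ | π.toHom g ξ = ξ} := by
    ext ξ
    simp [mem_fixed]
  rw [this]
  exact isClosed_biInter fun g _ => isClosed_eq (π.toHom g).continuous continuous_id

instance [CompleteSpace H] (K : Subgroup G) : CompleteSpace (π.fixed K) :=
  (π.isClosed_fixed K).completeSpace_coe

/-- The orbit of a vector under a subgroup. -/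
def orbit (K : Subgroup G) (ξ : H) : Set H := (fun g => π.toHom g ξ) '' (K : Set G)

variable {π} in
theorem map_mem_orbit {K : Subgroup G} {ξ η : H} (hη : η ∈ π.orbit K ξ) {g : G} (hg : g ∈ K) :
    π.toHom g η ∈ π.orbit K ξ := by
  obtain ⟨h, hh, rfl⟩ := hη
  exact ⟨g * h, K.mul_mem hg hh, π.map_mul_apply g h ξ⟩

theorem mem_orbit_self (K : Subgroup G) (ξ : H) : ξ ∈ π.orbit K ξ :=
  ⟨1, K.one_mem, π.map_one_apply ξ⟩

theorem norm_of_mem_orbit {K : Subgroup G} {ξ η : H} (hη : η ∈ π.orbit K ξ) : ‖η‖ = ‖ξ‖ := by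
  obtain ⟨h, hh, rfl⟩ := hη
  exact (π.toHom h).norm_map ξ

theorem map_mem_weakClosure_orbit {K : Subgroup G} {ξ η : H}
    (hη : η ∈ weakClosure (π.orbit K ξ)) {g : G} (hg : g ∈ K) :
    π.toHom g η ∈ weakClosure (π.orbit K ξ) := by
  refine weakClosure_subset_of_subset ?_ (weakClosure_image_subset (π.toHom g) hη)
  rintro _ ⟨ζ, hζ, rfl⟩
  exact subset_weakClosure _ (map_mem_orbit hζ hg)

/-- The closed convex hull of an orbit. -/
def hull (K : Subgroup G) (ξ : H) : Set H := closure (convexHull ℝ (π.orbit K ξ))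

theorem map_mem_hull {K : Subgroup G} {ξ η : H} (hη : η ∈ π.hull K ξ) {g : G} (hg : g ∈ K) :
    π.toHom g η ∈ π.hull K ξ := by
  have h1 : convexHull ℝ (π.orbit K ξ) ⊆ π.toHom g ⁻¹' convexHull ℝ (π.orbit K ξ) := by
    refine convexHull_min (fun ζ hζ => subset_convexHull ℝ _ (map_mem_orbit hζ hg)) ?_
    exact (convex_convexHull ℝ _).linear_preimage
      ((π.toHom g).toLinearEquiv.toLinearMap.restrictScalars ℝ)
  exact map_mem_closure (π.toHom g).continuous hη fun ζ hζ => h1 hζ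

variable [CompleteSpace H]

/-- The orthogonal projection to the vectors fixed by a subgroup. -/
noncomputable def proj (K : Subgroup G) : H →L[ℂ] H := (π.fixed K).starProjection

theorem proj_mem (K : Subgroup G) (ξ : H) : π.proj K ξ ∈ π.fixed K :=
  Submodule.starProjection_apply_mem _ ξ

variable {π} in
theorem proj_eq_self {K : Subgroup G} {ξ : H} (h : ξ ∈ π.fixed K) : π.proj K ξ = ξ :=
  Submodule.starProjection_eq_self_iff.2 h

theorem inner_proj_left (K : Subgroup G) (ξ η : H) : ⟪π.proj K ξ, η⟫ = ⟪ξ, π.proj K η⟫ :=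
  Submodule.inner_starProjection_left_eq_right _ ξ η

theorem norm_proj_le (K : Subgroup G) (ξ : H) : ‖π.proj K ξ‖ ≤ ‖ξ‖ :=
  Submodule.norm_starProjection_apply_le _ ξ

variable {π} in
theorem proj_eq_of_inner {K : Subgroup G} {ξ η : H} (hη : η ∈ π.fixed K)
    (h : ∀ ζ ∈ π.fixed K, ⟪ξ, ζ⟫ = ⟪η, ζ⟫) : π.proj K ξ = η :=
  (Submodule.eq_starProjection_of_mem_of_inner_eq_zero hη fun ζ hζ => by
    rw [inner_sub_left, h ζ hζ, sub_self])

theorem proj_map {K : Subgroup G} {g : G} (hg : g ∈ K) (ξ : H) :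
    π.proj K (π.toHom g ξ) = π.proj K ξ :=
  proj_eq_of_inner (π.proj_mem K ξ) fun ζ hζ => by
    rw [inner_map_left, hζ _ (K.inv_mem hg), inner_proj_left, proj_eq_self hζ]

theorem re_inner_self_proj (K : Subgroup G) (ξ : H) : ⟪ξ, π.proj K ξ⟫.re = ‖π.proj K ξ‖ ^ 2 := by
  have h : ⟪ξ, π.proj K ξ⟫ = ⟪π.proj K ξ, π.proj K ξ⟫ := by
    rw [inner_proj_left, proj_eq_self (π.proj_mem K ξ)]
  rw [h]
  exact inner_self_eq_norm_sq (𝕜 := ℂ) _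

/-- The projection of a vector to the fixed vectors is in the closed convex hull of its orbit. -/
theorem proj_mem_hull (K : Subgroup G) (ξ : H) : π.proj K ξ ∈ π.hull K ξ := by
  let _ : InnerProductSpace ℝ H := InnerProductSpace.complexToReal
  have hconv : Convex ℝ (π.hull K ξ) := (convex_convexHull ℝ _).closure
  have hξ : ξ ∈ π.hull K ξ := subset_closure (subset_convexHull ℝ _ (π.mem_orbit_self K ξ))
  obtain ⟨η, hη, hmin⟩ := exists_norm_eq_iInf_of_complete_convex ⟨ξ, hξ⟩
    isClosed_closure.isComplete hconv (0 : H)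
  -- Translates of `η` by `K` are also nearest to the origin in the hull; adding the two variational
  -- inequalities forces them to equal `η`.
  have hfix : η ∈ π.fixed K := by
    intro g hg
    have hgη := π.map_mem_hull hη hg
    have hmin' : ‖0 - π.toHom g η‖ = ⨅ w : π.hull K ξ, ‖0 - (w : H)‖ := by
      rw [zero_sub, norm_neg, (π.toHom g).norm_map, ← norm_neg, ← zero_sub]
      exact hmin
    have h1 := (norm_eq_iInf_iff_real_inner_le_zero hconv hη).1 hmin _ hgη
    have h2 := (norm_eq_iInf_iff_real_inner_le_zero hconv hgη).1 hmin' _ hη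
    have h3 : inner ℝ (π.toHom g η - η) (π.toHom g η - η) ≤ 0 := by
      simp only [zero_sub, inner_neg_left, inner_sub_left, inner_sub_right] at h1 h2 ⊢
      linarith
    rw [real_inner_self_eq_norm_sq] at h3
    have h4 : ‖π.toHom g η - η‖ = 0 := by nlinarith [norm_nonneg (π.toHom g η - η)]
    exact sub_eq_zero.1 (norm_eq_zero.1 h4)
  have hsub : π.hull K ξ ⊆ {ζ | π.proj K ζ = π.proj K ξ} := by
    refine closure_minimal (convexHull_min ?_ ?_)
      (isClosed_eq (π.proj K).continuous continuous_const)
    · rintro _ ⟨g, hg, rfl⟩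
      exact π.proj_map hg ξ
    · exact (convex_singleton (π.proj K ξ)).linear_preimage
        ((π.proj K).toLinearMap.restrictScalars ℝ)
  have := hsub hη
  rw [Set.mem_ofPred_eq, proj_eq_self hfix] at this
  rwa [← this]

theorem norm_proj_sub_le {K : Subgroup G} {ξ : H} {ε : ℝ} (h : ∀ g ∈ K, ‖π.toHom g ξ - ξ‖ ≤ ε) :
    ‖π.proj K ξ - ξ‖ ≤ ε := by
  have hsub : π.hull K ξ ⊆ Metric.closedBall ξ ε := by
    refine closure_minimal (convexHull_min ?_ (convex_closedBall ξ ε)) Metric.isClosed_closedBall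
    rintro _ ⟨g, hg, rfl⟩
    exact mem_closedBall_iff_norm.2 (h g hg)
  exact mem_closedBall_iff_norm.1 (hsub (π.proj_mem_hull K ξ))

end UnitaryRep

end Fixed

/-! ### Commutation of the projections. -/

section Commuting

open Filter Topology
open scoped ComplexInnerProductSpace

theorem exists_eq_of_antitone_of_finite_range {a : ℕ → ℝ} (ha : Antitone a)
    (hfin : (Set.range a).Finite) : ∃ n, a (n + 1) = a n := by
  by_contra! hne
  have hanti : StrictAnti a := strictAnti_nat_of_succ_lt fun n =>
    lt_of_le_of_ne (ha n.le_succ) (hne n)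
  exact Set.infinite_range_of_injective hanti.injective hfin

/-- The pointwise stabilizer of a finite set. -/
abbrev stab (G : Type*) {X : Type*} [Group G] [MulAction G X] (A : Finset X) : Subgroup G :=
  fixingSubgroup G (A : Set X)

theorem stab_anti {G : Type*} {X : Type*} [Group G] [MulAction G X] {A B : Finset X}
    (h : A ⊆ B) : stab G B ≤ stab G A :=
  fixingSubgroup_antitone _ _ (Finset.coe_subset.2 h)

variable {G : Type*} [Group G] [TopologicalSpace G] {H : Type*} [NormedAddCommGroup H]
  [InnerProductSpace ℂ H] {X : Type*} [MulAction G X]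

/-- The stabilizer of a vector. -/
def UnitaryRep.vectorStabilizer (π : UnitaryRep G H) (ξ : H) : Subgroup G where
  carrier := {g | π.toHom g ξ = ξ}
  mul_mem' := fun {g h} hg hh => by
    have hg' : π.toHom g ξ = ξ := hg
    have hh' : π.toHom h ξ = ξ := hh
    rw [Set.mem_ofPred_eq, π.map_mul_apply, hh', hg']
  one_mem' := π.map_one_apply ξ
  inv_mem' := fun {g} hg => by
    have hg' : π.toHom g ξ = ξ := hg
    rw [Set.mem_ofPred_eq]
    nth_rewrite 1 [← hg']
    exact π.map_inv_map g ξ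

variable [DecidableEq X]

namespace StabilizerCalculus

variable (π : UnitaryRep G H)

theorem fixed_inf_fixed_le (S : StabilizerCalculus G X) (A B : Finset X) :
    π.fixed (stab G A) ⊓ π.fixed (stab G B) ≤ π.fixed (stab G (A ∩ B)) := by
  intro ξ hξ
  exact S.fixing_inter_le A B (π.vectorStabilizer ξ) hξ.1 hξ.2

theorem finite_range_inner (S : StabilizerCalculus G X) {E : Finset X} {ξ : H}
    (hξ : ξ ∈ π.fixed (stab G E)) :
    (Set.range fun g => ⟪π.toHom g ξ, ξ⟫).Finite :=
  S.finite_range E _ fun g h hh => by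
    refine ⟨?_, ?_⟩
    · rw [π.map_mul_apply, π.inner_map_left, hξ _ (Subgroup.inv_mem _ hh)]
    · rw [π.map_mul_apply, hξ _ hh]

/-- The distances ‖gξ − ξ‖ take finitely many values, so the orbit is uniformly discrete. Being
totally bounded, it is finite, and the finite-index property of stabilizers applies. -/
theorem fixed_of_totallyBounded_of_fixed (S : StabilizerCalculus G X) {A E : Finset X}
    {ξ : H} (hE : ξ ∈ π.fixed (stab G E))
    (htb : TotallyBounded (π.orbit (stab G A) ξ)) : ξ ∈ π.fixed (stab G A) := by
  have hfin : (Set.range fun g => ‖π.toHom g ξ - ξ‖).Finite := by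
    refine ((S.finite_range_inner π hE).image
      fun c => Real.sqrt (‖ξ‖ ^ 2 - 2 * c.re + ‖ξ‖ ^ 2)).subset ?_
    rintro _ ⟨g, rfl⟩
    refine ⟨_, ⟨g, rfl⟩, ?_⟩
    have := norm_sub_sq (𝕜 := ℂ) (π.toHom g ξ) ξ
    rw [(π.toHom g).norm_map] at this
    exact (congrArg Real.sqrt this.symm).trans (Real.sqrt_sq (norm_nonneg _))
  obtain ⟨δ, hδ, hgap⟩ : ∃ δ > 0, ∀ g, ‖π.toHom g ξ - ξ‖ < δ → π.toHom g ξ = ξ := by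
    have hcl : IsClosed ((Set.range fun g => ‖π.toHom g ξ - ξ‖) \ {0}) :=
      (hfin.subset Set.sdiff_subset).isClosed
    obtain ⟨δ, hδ, hball⟩ := Metric.isOpen_iff.1 hcl.isOpen_compl 0 (by simp)
    refine ⟨δ, hδ, fun g hg => ?_⟩
    by_contra hne
    refine hball (a := ‖π.toHom g ξ - ξ‖) (by simpa using hg) ⟨⟨g, rfl⟩, ?_⟩
    simpa [sub_eq_zero] using hne
  obtain ⟨t, hts, htfin, ht⟩ := totallyBounded_iff_subset.1 htb _ (Metric.dist_mem_uniformity hδ)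
  choose! k hk hkt using fun y (hy : y ∈ t) => hts hy
  refine S.fixing_le_of_finite_index A E (π.vectorStabilizer ξ) hE (k '' t)
    (htfin.image k) fun g hg => ?_
  obtain ⟨y, hy, hgy⟩ := Set.mem_iUnion₂.1 (ht ⟨g, hg, rfl⟩)
  refine ⟨k y, ⟨y, hy, rfl⟩, hgap _ ?_⟩
  have h1 : dist (π.toHom g ξ) y < δ := hgy
  have h2 : π.toHom (k y) ξ = y := hkt y hy
  rw [← h2, dist_eq_norm] at h1
  rwa [π.map_mul_apply, ← (π.toHom (k y)).norm_map, map_sub, π.map_map_inv]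

variable [CompleteSpace H]

/-- Vectors fixed by stabilizers of finite sets are dense. -/
theorem exists_norm_proj_sub_le (S : StabilizerCalculus G X) (ξ : H) {ε : ℝ} (hε : 0 < ε) :
    ∃ F : Finset X, ∀ E, F ⊆ E → ‖π.proj (stab G E) ξ - ξ‖ ≤ ε := by
  have h1 : {g : G | ‖π.toHom g ξ - ξ‖ < ε} ∈ 𝓝 (1 : G) := by
    have hc : Continuous fun g => ‖π.toHom g ξ - ξ‖ :=
      ((π.strongly_continuous ξ).sub continuous_const).norm
    refine hc.continuousAt.preimage_mem_nhds (Iio_mem_nhds ?_)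
    rwa [π.map_one_apply, sub_self, norm_zero]
  obtain ⟨F, hF⟩ := S.exists_fixing_subset _ h1
  exact ⟨F, fun E hFE => π.norm_proj_sub_le fun g hg => (hF g (stab_anti hFE hg)).le⟩

/-- Vectors whose orbit under the stabilizer of a finite set is totally bounded are fixed by it. -/
theorem fixed_of_totallyBounded (S : StabilizerCalculus G X) {A : Finset X} {ξ : H}
    (htb : TotallyBounded (π.orbit (stab G A) ξ)) : ξ ∈ π.fixed (stab G A) := by
  have hE : ∀ E, A ⊆ E → π.proj (stab G E) ξ ∈ π.fixed (stab G A) := by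
    intro E hAE
    refine S.fixed_of_totallyBounded_of_fixed π (π.proj_mem _ ξ) ?_
    have hhull : TotallyBounded (π.hull (stab G A) ξ) := htb.convexHull.closure
    refine hhull.subset ?_
    have hmem : π.proj (stab G E) ξ ∈ π.hull (stab G A) ξ :=
      closure_mono (convexHull_mono (Set.image_mono (stab_anti hAE))) (π.proj_mem_hull _ ξ)
    rintro _ ⟨g, hg, rfl⟩
    exact π.map_mem_hull hmem hg
  have : ξ ∈ closure (π.fixed (stab G A) : Set H) := by
    refine Metric.mem_closure_iff.2 fun ε hε => ?_
    obtain ⟨F, hF⟩ := S.exists_norm_proj_sub_le π ξ (half_pos hε)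
    refine ⟨_, hE (A ∪ F) Finset.subset_union_left, ?_⟩
    rw [dist_comm, dist_eq_norm]
    exact (hF _ Finset.subset_union_right).trans_lt (half_lt_self hε)
  rwa [(π.isClosed_fixed _).closure_eq] at this

/-- A weak limit of minimal norm has an orbit with no shorter weak limits, hence a totally bounded
one, so it is fixed. Pairing with fixed vectors identifies it with the projection. -/
theorem proj_mem_weakClosure_orbit (S : StabilizerCalculus G X) (A : Finset X) (ξ : H) :
    π.proj (stab G A) ξ ∈ weakClosure (π.orbit (stab G A) ξ) := by
  obtain ⟨w, hw, hmin⟩ := exists_mem_weakClosure_norm_le ⟨ξ, π.mem_orbit_self (stab G A) ξ⟩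
  have hwA : w ∈ π.fixed (stab G A) := by
    refine S.fixed_of_totallyBounded π (totallyBounded_of_norm_le_weakClosure
      (fun x hx => π.norm_of_mem_orbit hx) fun x hx => hmin x ?_)
    refine weakClosure_subset_of_subset ?_ hx
    rintro _ ⟨g, hg, rfl⟩
    exact π.map_mem_weakClosure_orbit hw hg
  convert hw
  refine UnitaryRep.proj_eq_of_inner hwA fun ζ hζ => ?_
  obtain ⟨U, hU, hlim⟩ := mem_weakClosure_iff.1 hw
  refine tendsto_nhds_unique (tendsto_const_nhds.congr' ?_) (hlim ζ)
  refine Filter.mem_of_superset hU ?_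
  rintro _ ⟨g, hg, rfl⟩
  change ⟪ξ, ζ⟫ = ⟪π.toHom g ξ, ζ⟫
  rw [π.inner_map_left, hζ _ (Subgroup.inv_mem _ hg)]

theorem proj_mem_weakClosure_orbit_top (S : StabilizerCalculus G X) (A : Finset X) {ξ η : H}
    (hη : η ∈ weakClosure (π.orbit ⊤ ξ)) : π.proj (stab G A) η ∈ weakClosure (π.orbit ⊤ ξ) := by
  refine weakClosure_subset_of_subset ?_ (S.proj_mem_weakClosure_orbit π A η)
  rintro _ ⟨g, -, rfl⟩
  exact π.map_mem_weakClosure_orbit hη trivial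

/-- The projections to the fixed vectors of stabilizers of finite sets commute. -/
theorem proj_of_mem_fixed (S : StabilizerCalculus G X) (A B : Finset X) {ξ : H}
    (hξ : ξ ∈ π.fixed (stab G A)) :
    π.proj (stab G B) ξ = π.proj (stab G (A ∩ B)) ξ := by
  set p := π.proj (stab G A)
  set q := π.proj (stab G B)
  set r := π.proj (stab G (A ∩ B))
  have hsymm : ∀ x y : H, ⟪p (q (p x)), y⟫ = ⟪x, p (q (p y))⟫ := fun x y => by
    rw [π.inner_proj_left, π.inner_proj_left, π.inner_proj_left]
  let T : H → H := fun x => p (q (p x))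
  have hTsymm : ∀ (n : ℕ) (x y : H), ⟪T^[n] x, y⟫ = ⟪x, T^[n] y⟫ := by
    intro n
    induction n with
    | zero => intro x y; rfl
    | succ n ih =>
      intro x y
      rw [Function.iterate_succ_apply', hsymm, ih, Function.iterate_succ_apply]
  have hTnorm : ∀ x, ‖T x‖ ≤ ‖x‖ := fun x =>
    (π.norm_proj_le _ _).trans ((π.norm_proj_le _ _).trans (π.norm_proj_le _ _))
  have hmem : ∀ n, T^[n] ξ ∈ weakClosure (π.orbit ⊤ ξ) := by
    intro n
    induction n with
    | zero => exact subset_weakClosure _ (π.mem_orbit_self ⊤ ξ)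
    | succ n ih =>
      rw [Function.iterate_succ_apply']
      exact S.proj_mem_weakClosure_orbit_top π _ (S.proj_mem_weakClosure_orbit_top π _
        (S.proj_mem_weakClosure_orbit_top π _ ih))
  -- ‖Tⁿξ‖² = ⟨T²ⁿξ, ξ⟩ is a limit of coefficients ⟨gξ, ξ⟩, which form a finite and hence closed
  -- set.
  have hfinite : (Set.range fun n => ‖T^[n] ξ‖).Finite := by
    have h1 := S.finite_range_inner π hξ
    refine (h1.image fun c => Real.sqrt c.re).subset ?_
    rintro _ ⟨n, rfl⟩
    refine ⟨⟪T^[n + n] ξ, ξ⟫, ?_, ?_⟩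
    · obtain ⟨U, hU, hlim⟩ := mem_weakClosure_iff.1 (hmem (n + n))
      refine h1.isClosed.mem_of_tendsto (hlim ξ) (Filter.mem_of_superset hU ?_)
      rintro _ ⟨g, -, rfl⟩
      exact ⟨g, rfl⟩
    · rw [Function.iterate_add_apply, hTsymm]
      have h2 : (⟪T^[n] ξ, T^[n] ξ⟫).re = ‖T^[n] ξ‖ ^ 2 := inner_self_eq_norm_sq (𝕜 := ℂ) _
      exact (congrArg Real.sqrt h2).trans (Real.sqrt_sq (norm_nonneg _))
  obtain ⟨n, hn⟩ := exists_eq_of_antitone_of_finite_range (a := fun n => ‖T^[n] ξ‖)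
    (antitone_nat_of_succ_le fun n => by
      rw [Function.iterate_succ_apply']
      exact hTnorm _) hfinite
  have hmemfix : ∀ (K : Subgroup G) (x : H), ‖x‖ ≤ ‖π.proj K x‖ → x ∈ π.fixed K := fun K x hx =>
    (Submodule.mem_iff_norm_starProjection (π.fixed K) x).2 ((π.norm_proj_le K x).antisymm hx)
  -- Once the norm stops decreasing, neither projection shortens the iterate, so it is fixed by both
  -- stabilizers.
  have hAB : T^[n] ξ ∈ π.fixed (stab G (A ∩ B)) := by
    simp only [Function.iterate_succ_apply'] at hn
    have h1 : T^[n] ξ ∈ π.fixed (stab G A) := hmemfix _ _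
      (hn.symm.le.trans ((π.norm_proj_le _ _).trans (π.norm_proj_le _ _)))
    have h2 : p (T^[n] ξ) = T^[n] ξ := UnitaryRep.proj_eq_self h1
    refine S.fixed_inf_fixed_le π A B ⟨h1, hmemfix _ _ ?_⟩
    refine hn.symm.le.trans ((π.norm_proj_le _ _).trans ?_)
    rw [h2]
  have hrA : ∀ x, p (r x) = r x := fun x =>
    UnitaryRep.proj_eq_self (π.fixed_anti (stab_anti Finset.inter_subset_left) (π.proj_mem _ x))
  have hrB : ∀ x, q (r x) = r x := fun x =>
    UnitaryRep.proj_eq_self (π.fixed_anti (stab_anti Finset.inter_subset_right) (π.proj_mem _ x))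
  have hTr : ∀ n x, T^[n] (r x) = r x := fun n x =>
    Function.iterate_fixed (show p (q (p (r x))) = r x by rw [hrA, hrB, hrA]) n
  have hrT : r ξ = T^[n] ξ := UnitaryRep.proj_eq_of_inner hAB fun ζ hζ => by
    have hζr : r ζ = ζ := UnitaryRep.proj_eq_self hζ
    rw [hTsymm, ← hζr, hTr]
  have hTsub : ∀ n x y, T^[n] (x - y) = T^[n] x - T^[n] y := by
    intro n
    induction n with
    | zero => intro x y; rfl
    | succ n ih =>
      intro x y
      simp only [Function.iterate_succ_apply', ih]
      simp only [T, map_sub]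
  -- A symmetric operator has the same kernel as its positive powers.
  have hker : ∀ n x, T^[n + 1] x = 0 → T x = 0 := by
    intro n
    induction n with
    | zero => intro x hx; exact hx
    | succ n ih =>
      intro x hx
      refine ih x ?_
      have : ⟪T^[n + 1] x, T^[n + 1] x⟫ = 0 := by
        nth_rewrite 2 [Function.iterate_succ_apply']
        change ⟪_, p (q (p (T^[n] x)))⟫ = 0
        rw [← hsymm]
        change ⟪T (T^[n + 1] x), _⟫ = 0
        rw [← Function.iterate_succ_apply' T, hx, inner_zero_left]
      exact inner_self_eq_zero.1 this
  have hTu : T (ξ - r ξ) = 0 := by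
    refine hker n _ ?_
    rw [Function.iterate_succ_apply', hTsub, hTr, ← hrT, sub_self]
    simp [T]
  have hpu : p (ξ - r ξ) = ξ - r ξ := by
    rw [map_sub, hrA, UnitaryRep.proj_eq_self hξ]
  -- For u = ξ − rξ, which `p` fixes, ‖qu‖² = ⟨u, qu⟩ = ⟨u, Tu⟩ = 0.
  have hqu : q (ξ - r ξ) = 0 := by
    have h1 : ⟪ξ - r ξ, q (ξ - r ξ)⟫ = 0 := by
      nth_rewrite 1 [← hpu]
      rw [π.inner_proj_left]
      nth_rewrite 2 [← hpu]
      change ⟪_, T _⟫ = 0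
      rw [hTu, inner_zero_right]
    have h2 := π.re_inner_self_proj (stab G B) (ξ - r ξ)
    rw [h1] at h2
    simpa using h2.symm
  rw [map_sub, hrB, sub_eq_zero] at hqu
  exact hqu

end StabilizerCalculus

end Commuting

/-! ### Orthogonal decomposition over finite subsets. -/

section Decomposition

open Filter Topology
open scoped ComplexInnerProductSpace Pointwise

variable {G : Type*} [Group G] [TopologicalSpace G] {H : Type*} [NormedAddCommGroup H]
  [InnerProductSpace ℂ H] {X : Type*} [MulAction G X]

namespace UnitaryRep

variable (π : UnitaryRep G H)

/-- The vectors fixed by the stabilizer of `F` and orthogonal to those fixed by the stabilizer of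
a proper subset of `F`. -/
noncomputable def pure (F : Finset X) : Submodule ℂ H :=
  π.fixed (stab G F) ⊓ ⨅ F' : {F' : Finset X // F' ⊂ F}, (π.fixed (stab G F'.1))ᗮ

variable {π} in
theorem mem_pure {F : Finset X} {ξ : H} : ξ ∈ π.pure F ↔
    ξ ∈ π.fixed (stab G F) ∧ ∀ F' ⊂ F, ∀ η ∈ π.fixed (stab G F'), ⟪η, ξ⟫ = 0 := by
  simp [pure, Submodule.mem_iInf, Submodule.mem_orthogonal]

theorem isClosed_pure (F : Finset X) : IsClosed (π.pure F : Set H) := by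
  have : (π.pure F : Set H) = (π.fixed (stab G F) : Set H) ∩
      ⋂ F' : {F' : Finset X // F' ⊂ F}, ((π.fixed (stab G F'.1))ᗮ : Submodule ℂ H) := by
    simp [pure]
  rw [this]
  exact (π.isClosed_fixed _).inter (isClosed_iInter fun F' => Submodule.isClosed_orthogonal _)

instance [CompleteSpace H] (F : Finset X) : CompleteSpace (π.pure F) :=
  (π.isClosed_pure F).completeSpace_coe

section Mass

variable [CompleteSpace H]

/-- The mass that a vector puts on a finite set of points. -/
noncomputable def mass (ξ : H) (F : Finset X) : ℝ := ‖(π.pure F).starProjection ξ‖ ^ 2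

theorem mass_nonneg (ξ : H) (F : Finset X) : 0 ≤ π.mass ξ F := sq_nonneg _

/-- The constants come from (a + b)² ≤ (3/2)a² + 3b², that is, from (a − 2b)² ≥ 0. Any factor below
2 on the first term would suit the final estimate, with a smaller ε if needed. -/
theorem mass_le (ξ η : H) (F : Finset X) :
    π.mass ξ F ≤ 3 / 2 * π.mass η F + 3 * π.mass (ξ - η) F := by
  set p := (π.pure F).starProjection
  have h : ‖p ξ‖ ≤ ‖p η‖ + ‖p (ξ - η)‖ := by
    rw [map_sub]
    exact norm_le_insert' _ _
  have h1 := norm_nonneg (p ξ)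
  change ‖p ξ‖ ^ 2 ≤ 3 / 2 * ‖p η‖ ^ 2 + 3 * ‖p (ξ - η)‖ ^ 2
  nlinarith [sq_nonneg (‖p η‖ - 2 * ‖p (ξ - η)‖)]

theorem mass_empty (hπ : π.fixed (⊤ : Subgroup G) = ⊥) (ξ : H) :
    π.mass ξ (∅ : Finset X) = 0 := by
  have h : (π.pure (∅ : Finset X)).starProjection ξ ∈ π.fixed (⊤ : Subgroup G) := by
    intro g _
    refine (mem_pure.1 (Submodule.starProjection_apply_mem (π.pure ∅) ξ)).1 g ?_
    simp [mem_fixingSubgroup_iff]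
  rw [hπ, Submodule.mem_bot] at h
  rw [mass, h]
  simp

end Mass

variable [DecidableEq X]

variable {π} in
theorem map_mem_fixed {F : Finset X} {ξ : H} (hξ : ξ ∈ π.fixed (stab G F)) (g : G) :
    π.toHom g ξ ∈ π.fixed (stab G (g • F)) := by
  intro h hh
  have h1 : g⁻¹ * h * g ∈ stab G F := by
    rw [mem_fixingSubgroup_iff] at hh ⊢
    intro x hx
    rw [mul_smul, mul_smul, hh _ (by simpa using hx), inv_smul_smul]
  have h2 := hξ _ h1
  rw [π.map_mul_apply, π.map_mul_apply] at h2
  rw [← π.map_map_inv g (π.toHom h _), h2]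

variable {π} in
theorem map_mem_pure {F : Finset X} {ξ : H} (hξ : ξ ∈ π.pure F) (g : G) :
    π.toHom g ξ ∈ π.pure (g • F) := by
  rw [mem_pure] at hξ ⊢
  refine ⟨map_mem_fixed hξ.1 g, fun F' hF' η hη => ?_⟩
  rw [← inv_inv g, ← π.inner_map_left]
  refine hξ.2 (g⁻¹ • F') ?_ _ (map_mem_fixed hη g⁻¹)
  rw [← inv_smul_smul g F]
  exact ⟨Finset.smul_finset_subset_smul_finset_iff.2 hF'.1,
    fun h => hF'.2 (Finset.smul_finset_subset_smul_finset_iff.1 h)⟩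

variable [CompleteSpace H]

theorem mass_map (g : G) (ξ : H) (F : Finset X) : π.mass (π.toHom g ξ) (g • F) = π.mass ξ F := by
  have h : (π.pure (g • F)).starProjection (π.toHom g ξ) =
      π.toHom g ((π.pure F).starProjection ξ) := by
    refine (Submodule.eq_starProjection_of_mem_of_inner_eq_zero
      (map_mem_pure (Submodule.starProjection_apply_mem _ ξ) g) fun ζ hζ => ?_)
    rw [← map_sub, π.inner_map_left]
    refine Submodule.starProjection_inner_eq_zero _ _ ?_
    simpa using map_mem_pure hζ g⁻¹
  rw [mass, mass, h, (π.toHom g).norm_map]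

end UnitaryRep

variable [DecidableEq X]

namespace StabilizerCalculus

variable (π : UnitaryRep G H) [CompleteSpace H]

/-- If A ⊄ B, projecting η ∈ `pure B` to the G_A-fixed vectors lands in those fixed by G_{A∩B}, and
A ∩ B is a proper subset of A; so η is orthogonal to `pure A`. -/
theorem orthogonalFamily_pure (S : StabilizerCalculus G X) :
    OrthogonalFamily ℂ (fun F : Finset X => π.pure F) fun F => (π.pure F).subtypeₗᵢ := by
  have key : ∀ (A B : Finset X) (ξ η : H), ξ ∈ π.pure A → η ∈ π.pure B → ¬ A ⊆ B →
      ⟪ξ, η⟫ = 0 := by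
    intro A B ξ η hξ hη hAB
    rw [UnitaryRep.mem_pure] at hξ hη
    have h1 : A ∩ B ⊂ A := ⟨Finset.inter_subset_left, fun h => hAB
      (h.trans Finset.inter_subset_right)⟩
    have h2 := hξ.2 _ h1 _ (π.proj_mem (stab G (A ∩ B)) η)
    have h3 := S.proj_of_mem_fixed π B A hη.1
    rw [Finset.inter_comm] at h3
    rw [← h3, π.inner_proj_left, UnitaryRep.proj_eq_self hξ.1] at h2
    exact inner_eq_zero_symm.1 h2
  intro A B hAB ξ η
  by_cases h : (A : Finset X) ⊆ B
  · refine inner_eq_zero_symm.1 (key B A η ξ η.2 ξ.2 fun h' => hAB (h.antisymm h'))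
  · exact key A B ξ η ξ.2 η.2 h

/-- For a vector orthogonal to every piece, induction on `F` kills its projections: once those for
proper subsets vanish, the one for `F` is pure. Density of the fixed vectors finishes. -/
theorem isHilbertSum_pure (S : StabilizerCalculus G X) :
    IsHilbertSum ℂ (fun F : Finset X => π.pure F) fun F => (π.pure F).subtypeₗᵢ := by
  refine IsHilbertSum.mkInternal _ (S.orthogonalFamily_pure π) ?_
  rw [top_le_iff, Submodule.topologicalClosure_eq_top_iff, Submodule.eq_bot_iff]
  intro ξ hξ
  have horth : ∀ (F : Finset X), ∀ η ∈ π.pure F, ⟪η, ξ⟫ = 0 := fun F η hη =>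
    (Submodule.mem_orthogonal _ _).1 hξ η (Submodule.mem_iSup_of_mem F hη)
  have hproj : ∀ F : Finset X, π.proj (stab G F) ξ = 0 := by
    intro F
    induction F using Finset.strongInduction with
    | H F ih =>
      have hpure : π.proj (stab G F) ξ ∈ π.pure F := by
        refine UnitaryRep.mem_pure.2 ⟨π.proj_mem _ _, fun F' hF' η hη => ?_⟩
        rw [← π.inner_proj_left, UnitaryRep.proj_eq_self (π.fixed_anti (stab_anti hF'.1) hη),
          ← UnitaryRep.proj_eq_self hη, π.inner_proj_left, ih F' hF', inner_zero_right]
      have h1 := π.re_inner_self_proj (stab G F) ξ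
      rw [inner_eq_zero_symm.1 (horth F _ hpure)] at h1
      simpa using h1.symm
  refine norm_le_zero_iff.1 (le_of_forall_pos_le_add fun ε hε => ?_)
  obtain ⟨F, hF⟩ := S.exists_norm_proj_sub_le π ξ hε
  simpa [hproj] using hF F subset_rfl

theorem hasSum_mass (S : StabilizerCalculus G X) (ξ : H) :
    HasSum (fun F : Finset X => π.mass ξ F) (‖ξ‖ ^ 2) := by
  let e := (S.isHilbertSum_pure π).linearIsometryEquiv
  have he : ∀ F : Finset X, (π.pure F).starProjection ξ = (e ξ F : H) := fun F => by
    symm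
    refine (Submodule.eq_starProjection_of_mem_of_inner_eq_zero (e ξ F).2 fun ζ hζ => ?_).symm
    have h1 : ⟪ξ, ζ⟫ = ⟪e ξ, lp.single 2 F (⟨ζ, hζ⟩ : π.pure F)⟫ := by
      rw [← e.symm.inner_map_map, e.symm_apply_apply,
        IsHilbertSum.linearIsometryEquiv_symm_apply_single]
      rfl
    rw [lp.inner_single_right] at h1
    rw [inner_sub_left, h1]
    exact sub_self _
  have h2 := lp.hasSum_norm (p := 2) (by norm_num) (e ξ)
  simp only [ENNReal.toReal_ofNat, Real.rpow_ofNat, e.norm_map] at h2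
  convert h2 using 2 with F
  rw [UnitaryRep.mass, he]
  rfl

end StabilizerCalculus

end Decomposition

/-! ### The ping-pong estimate and property (T). -/

section Kazhdan

open scoped Pointwise

variable {X : Type*}

/-- The proportion of points of a given colour in a finite set. -/
noncomputable def colourRatio {κ : Type*} [DecidableEq κ] (c : X → κ) (k : κ) (F : Finset X) : ℝ :=
  (F.filter fun x => c x = k).card / F.card

theorem colourRatio_nonneg {κ : Type*} [DecidableEq κ] (c : X → κ) (k : κ) (F : Finset X) :
    0 ≤ colourRatio c k F := by
  unfold colourRatio; positivity

theorem colourRatio_le_one {κ : Type*} [DecidableEq κ] (c : X → κ) (k : κ) (F : Finset X) :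
    colourRatio c k F ≤ 1 :=
  div_le_one_of_le₀ (by exact_mod_cast Finset.card_filter_le _ _) (by positivity)

theorem sum_colourRatio {κ : Type*} [DecidableEq κ] [Fintype κ] (c : X → κ) {F : Finset X}
    (hF : F.Nonempty) : ∑ k, colourRatio c k F = 1 := by
  simp only [colourRatio]
  rw [← Finset.sum_div, div_eq_one_iff_eq (by exact_mod_cast hF.card_pos.ne')]
  exact_mod_cast (Finset.card_eq_sum_card_fiberwise
    (fun x _ => Finset.mem_coe.2 (Finset.mem_univ (c x)))).symm

theorem one_sub_colourRatio_le [DecidableEq X] {G : Type*} [Group G] [MulAction G X] {κ : Type*}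
    [DecidableEq κ]
    {c : X → κ} {k l : κ} {g : G} (h : ∀ x, c x ≠ k → c (g • x) = l) {F : Finset X}
    (hF : F.Nonempty) : 1 - colourRatio c k F ≤ colourRatio c l (g • F) := by
  have hpos : (0 : ℝ) < F.card := by exact_mod_cast hF.card_pos
  rw [colourRatio, colourRatio, Finset.card_smul_finset, one_sub_div hpos.ne',
    div_le_div_iff_of_pos_right hpos, sub_le_iff_le_add]
  have h1 : (F.filter fun x => ¬ c x = k).card ≤ ((g • F).filter fun x => c x = l).card := by
    refine Finset.card_le_card_of_injOn (fun x => g • x) (fun x hx => ?_)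
      (MulAction.injective g).injOn
    simp only [Finset.coe_filter, Set.mem_ofPred_eq] at hx ⊢
    exact ⟨Finset.smul_mem_smul_finset hx.1, h x hx.2⟩
  have h2 := Finset.card_filter_add_card_filter_not (s := F) (fun x => c x = k)
  have h3 : F.card ≤ ((g • F).filter fun x => c x = l).card + (F.filter fun x => c x = k).card := by
    omega
  exact_mod_cast h3

/-- A pair of elements playing ping-pong on the points is a Kazhdan set. -/
theorem StabilizerCalculus.isKazhdanPair [DecidableEq X] {G : Type u} [Group G] [TopologicalSpace G]
    [MulAction G X] (S : StabilizerCalculus G X) (g : Bool → G) (c : X → Bool × Bool)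
    (hc : ∀ i x, c x ≠ (i, false) → c (g i • x) = (i, true)) :
    IsKazhdanPair.{u, z} G (Set.range g) (1 / 10) := by
  intro H _ _ _ π ⟨ξ, hξ0, hξ⟩
  by_contra! hinv
  have hfix : π.fixed (⊤ : Subgroup G) = ⊥ := by
    refine (Submodule.eq_bot_iff _).2 fun η hη => ?_
    by_contra hne
    exact hinv η ⟨hne, fun g => hη g trivial⟩
  have hmass := S.hasSum_mass π
  have hempty : ∀ η : H, π.mass η (∅ : Finset X) = 0 := π.mass_empty hfix
  let f : Bool × Bool → Finset X → ℝ := fun k F => colourRatio c k F * π.mass ξ F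
  have hf : ∀ k, Summable (f k) := fun k =>
    (hmass ξ).summable.of_nonneg_of_le
      (fun F => mul_nonneg (colourRatio_nonneg c k F) (π.mass_nonneg ξ F))
      fun F => mul_le_of_le_one_left (π.mass_nonneg ξ F) (colourRatio_le_one c k F)
  let M : Bool × Bool → ℝ := fun k => ∑' F, f k F
  have hM : ∀ k, HasSum (f k) (M k) := fun k => (hf k).hasSum
  have htotal : ∑ k, M k = ‖ξ‖ ^ 2 := by
    refine (hasSum_sum fun k _ => hM k).unique ?_
    convert hmass ξ using 2 with F
    rw [← Finset.sum_mul]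
    rcases F.eq_empty_or_nonempty with rfl | hF
    · rw [hempty, mul_zero]
    · rw [sum_colourRatio c hF, one_mul]
  have hstep : ∀ i, ‖ξ‖ ^ 2 - M (i, false) ≤
      3 / 2 * M (i, true) + 3 * ‖π.toHom (g i) ξ - ξ‖ ^ 2 := by
    intro i
    have h1 := (hmass ξ).sub (hM (i, false))
    have h2 := ((hM (i, true)).mul_left (3 / 2)).add
      ((hmass (π.toHom (g i) ξ - ξ)).mul_left 3)
    -- Reindexing by F ↦ g i • F allows a termwise comparison.
    rw [← (MulAction.toPerm (g i) : Equiv.Perm (Finset X)).hasSum_iff] at h2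
    refine hasSum_le (fun F => ?_) h1 h2
    change π.mass ξ F - colourRatio c (i, false) F * π.mass ξ F ≤
      3 / 2 * (colourRatio c (i, true) (g i • F) * π.mass ξ (g i • F)) +
        3 * π.mass (π.toHom (g i) ξ - ξ) (g i • F)
    rcases F.eq_empty_or_nonempty with rfl | hF
    · simp [hempty]
    · have h3 := one_sub_colourRatio_le (hc i) hF
      have h4 := π.mass_le (π.toHom (g i) ξ) ξ (g i • F)
      have h5 := π.mass_map (g i) ξ F
      have h6 := colourRatio_nonneg c (i, true) (g i • F)
      have h7 := mul_le_of_le_one_left (π.mass_nonneg (π.toHom (g i) ξ - ξ) (g i • F))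
        (colourRatio_le_one c (i, true) (g i • F))
      calc π.mass ξ F - colourRatio c (i, false) F * π.mass ξ F
          = (1 - colourRatio c (i, false) F) * π.mass ξ F := by ring
        _ ≤ colourRatio c (i, true) (g i • F) * π.mass ξ F := by
          gcongr
          exact π.mass_nonneg ξ F
        _ = colourRatio c (i, true) (g i • F) * π.mass (π.toHom (g i) ξ) (g i • F) := by rw [h5]
        _ ≤ colourRatio c (i, true) (g i • F) * (3 / 2 * π.mass ξ (g i • F) +
            3 * π.mass (π.toHom (g i) ξ - ξ) (g i • F)) := by gcongr
        _ ≤ _ := by linarith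
  have hMnn : ∀ k, 0 ≤ M k := fun k => tsum_nonneg fun F =>
    mul_nonneg (colourRatio_nonneg c k F) (π.mass_nonneg ξ F)
  have hsmall : ∀ i, ‖π.toHom (g i) ξ - ξ‖ ^ 2 ≤ (1 / 10 * ‖ξ‖) ^ 2 := fun i =>
    pow_le_pow_left₀ (norm_nonneg _) (hξ _ ⟨i, rfl⟩) 2
  have hpos : 0 < ‖ξ‖ ^ 2 := by positivity
  simp only [Fintype.sum_prod_type, Fintype.sum_bool] at htotal
  -- Adding the two steps gives 2‖ξ‖² ≤ (3/2)‖ξ‖² + (6/100)‖ξ‖², which is absurd.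
  linarith [hstep true, hstep false, hsmall true, hsmall false, hMnn (true, false),
    hMnn (false, false)]

end Kazhdan

end OligoT

theorem mainTheorem4 (L : FirstOrder.Language.{u, v}) [L.IsRelational]
    [Countable (Σ n, L.Relations n)] (X : Type w) [L.Structure X]
    (hcat : OligoT.IsOmegaCategorical L X)
    (hhom : L.IsUltrahomogeneous X)
    (halg : OligoT.NoAlgebraicity L X)
    (hwei : OligoT.WeakElimImaginaries L X) :
    OligoT.HasPropertyT.{w, z} (OligoT.Aut L X) := by
  classical
  have := hcat.countable
  rcases finite_or_infinite X with hX | hX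
  -- In a finite structure all orbits are finite, so no algebraicity over ∅ leaves no points and the
  -- group is trivial.
  · have hempty : IsEmpty X := ⟨fun x => by
      simpa using halg.mem_of_finite_orbit ∅ (b := x) (Set.toFinite _)⟩
    have hsub : Subsingleton (OligoT.Aut L X) :=
      ⟨fun g h => FirstOrder.Language.Equiv.ext fun x => isEmptyElim x⟩
    refine ⟨∅, isCompact_empty, 1, one_pos, ?_⟩
    rintro H _ _ _ π ⟨ξ, hξ, -⟩
    exact ⟨ξ, hξ, fun g => by rw [Subsingleton.elim g 1, π.map_one_apply]⟩
  · obtain ⟨g, c, hc⟩ := OligoT.exists_pingPong halg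
    exact ⟨Set.range g, (Set.finite_range g).isCompact, 1 / 10, by norm_num,
      (OligoT.stabilizerCalculus hcat hhom halg hwei).isKazhdanPair g c hc⟩
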